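/- Let $\Phi_m=\sum_i\delta_{x_i}$ (the multicast transmitters) be a homogeneous Poisson point process on $\mathbb{R}^2$ with intensity $\lambda_m>0$. Given $\Phi_m$, let the receiver clusters $\Phi_{m,x_i}$ be independent point processes, the law of $\Phi_{m,x_i}$ depending only on $x_i$, such that $\Phi_{m,x_i}$ has intensity measure $\lambda_r\,|\,\cdot\cap B(x_i,R)|$, where $\lambda_r,R>0$, $|\cdot|$ is Lebesgue measure and $B(x,R)$ is the disc of radius $R$ about $x$; nothing else is assumed about the laws of the clusters. For every receiver $y$ of every cluster, every transmitter $x$ and every time slot $n\ge 1$, let $F_{y,x}(n)$ be an $\mathrm{Exp}(1)$ random variable; these variables are independent of each other and of all the positions. Let $\ell(r)=Ar^{\alpha}$ with $A>0$ and $\alpha>2$, let $\mathrm{SNR}^{-1}=\sigma^2/P_m$ with $\sigma^2\ge 0$ and $P_m>0$, let $T>0$ and $\tau_m\in\mathbb{N}$. For a receiver $y$ of the transmitter $x_i$ put $$\mathrm{SINR}_{y,x_i}(n)=\frac{F_{y,x_i}(n)/\ell(\|x_i-y\|)}{\mathrm{SNR}^{-1}+\sum_{j\neq i}F_{y,x_j}(n)/\ell(\|x_j-y\|)},$$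 and say that $y$ is covered if $\mathrm{SINR}_{y,x_i}(n)\ge T$ for some $n\in\{1,\dots,\tau_m\}$. Let $N_i$ be the number of covered receivers in the cluster of $x_i$. The mean number of covered receivers in the typical cluster is the Palm expectation with respect to $\Phi_m$, that is, for a bounded Borel set $B\subset\mathbb{R}^2$ with $|B|>0$, $$\mathbb{E}^o[N]=\frac{1}{\lambda_m|B|}\,\mathbb{E}\Big[\sum_{i:\,x_i\in B}N_i\Big].$$ Then, for every such $B$, $\mathbb{E}^o[N]$ is finite and $$\mathbb{E}^o[N]=2\pi\lambda_r\sum_{n=1}^{\tau_m}(-1)^{n+1}\binom{\tau_m}{n}\int_0^R r\,e^{-nT\,\mathrm{SNR}^{-1}A r^{\alpha}}\,e^{-\lambda_m K(\alpha,n)T^{2/\alpha}r^2}\,dr,$$ where $$K(\alpha,n)=\frac{2\pi}{\alpha}\int_0^{\infty}t^{-\frac{2}{\alpha}-1}\Big(1-\frac{1}{(1+t)^n}\Big)\,dt .$$ -/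

import Mathlib

open MeasureTheory ProbabilityTheory
open scoped ENNReal NNReal

namespace MulticastD2D

/-- The Euclidean plane. -/
abbrev Plane : Type := EuclideanSpace ℝ (Fin 2)

/-- A finite receiver cluster: the number `m` of receivers together with a sequence whose first `m`
terms are the receiver positions (the later terms play no role). -/
abbrev Cluster : Type := ℕ × (ℕ → Plane)

/-- The counting measure `∑ k < m, δ (y k)` of a cluster `(m, y)`. -/
noncomputable def clusterMeasure (c : Cluster) : Measure Plane :=
  ∑ k ∈ Finset.range c.1, Measure.dirac (c.2 k)

section Model

variable {Ω : Type*} [MeasurableSpace Ω]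

/-- The random counting measure `∑ i, δ (X i)` of a sequence of random points. -/
noncomputable def pointMeasure (X : ℕ → Ω → Plane) (ω : Ω) : Measure Plane :=
  Measure.sum fun i => Measure.dirac (X i ω)

/-- The points `X 0, X 1, …` form a Poisson point process with intensity measure `μ`: counts of sets
of finite `μ`-measure are Poisson distributed, and counts of pairwise disjoint sets are
independent. -/
structure IsPoissonProcess (P : Measure Ω) (X : ℕ → Ω → Plane) (μ : Measure Plane) : Prop where
  measurable : ∀ i, Measurable (X i)
  count_law : ∀ A : Set Plane, MeasurableSet A → μ A ≠ ⊤ → ∀ k : ℕ,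
    P {ω | pointMeasure X ω A = (k : ℝ≥0∞)} = poissonMeasure (μ A).toNNReal {k}
  count_indep : ∀ (m : ℕ) (A : Fin m → Set Plane), (∀ a, MeasurableSet (A a)) →
    (∀ a b, a ≠ b → Disjoint (A a) (A b)) →
    iIndepFun (fun a ω => pointMeasure X ω (A a)) P

/-- The clusters `C i` are independent marks of the points `X i` with mark kernel `κ`: given all the
points, the marks are independent and the mark of `X i` has law `κ (X i)`. -/
structure IsIndependentMarking (P : Measure Ω) (X : ℕ → Ω → Plane) (C : ℕ → Ω → Cluster)
    (κ : Kernel Plane Cluster) : Prop where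
  measurable : ∀ i, Measurable (C i)
  law : ∀ (D : Set (ℕ → Plane)) (s : Finset ℕ) (S : ℕ → Set Cluster), MeasurableSet D →
    (∀ i, MeasurableSet (S i)) →
    P {ω | (fun i => X i ω) ∈ D ∧ ∀ i ∈ s, C i ω ∈ S i} =
      ∫⁻ ω in {ω | (fun i => X i ω) ∈ D}, ∏ i ∈ s, κ (X i ω) (S i) ∂P

/-- The stochastic model. `X i` is the position of the `i`-th multicast transmitter, `C i` its
cluster of intended receivers, and `F (i, k, j, n)` is the power fading, in time slot `n`, of the
link from transmitter `j` to the `k`-th receiver of the cluster of transmitter `i`. -/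
structure IsMulticastModel (P : Measure Ω) (X : ℕ → Ω → Plane) (C : ℕ → Ω → Cluster)
    (κ : Kernel Plane Cluster) (F : ℕ × ℕ × ℕ × ℕ → Ω → ℝ) (lamM lamR R : ℝ) : Prop where
  transmitters : IsPoissonProcess P X (ENNReal.ofReal lamM • volume)
  clusters : IsIndependentMarking P X C κ
  /-- The receivers of a transmitter at `x` have intensity measure `lamR • volume` on the disc of
  radius `R` about `x`; nothing else is assumed about their law. -/
  receiver_intensity : ∀ (x : Plane) (A : Set Plane), MeasurableSet A →
    ∫⁻ c, clusterMeasure c A ∂(κ x) =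
      ENNReal.ofReal lamR * volume (A ∩ Metric.closedBall x R)
  fading_measurable : ∀ q, Measurable (F q)
  fading_law : ∀ q, P.map (F q) = expMeasure 1
  fading_indep : iIndepFun F P
  fading_indep_positions :
    IndepFun (fun ω => ((fun i => X i ω), (fun i => C i ω))) (fun ω q => F q ω) P

/-- The signal-to-interference-plus-noise ratio at a receiver at `y` for the signal of the `i`-th
of the transmitters at `x 0, x 1, …`, with path-loss function `ℓ`, inverse signal-to-noise ratio
`snrInv` and power fading `f j` on the link from the `j`-th transmitter. -/
noncomputable def sinr (ℓ : ℝ → ℝ) (snrInv : ℝ) (x : ℕ → Plane) (i : ℕ) (y : Plane)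
    (f : ℕ → ℝ) : ℝ≥0∞ :=
  (ENNReal.ofReal (f i) / ENNReal.ofReal (ℓ ‖x i - y‖)) /
    (ENNReal.ofReal snrInv +
      ∑' j : {j : ℕ // j ≠ i}, ENNReal.ofReal (f j) / ENNReal.ofReal (ℓ ‖x j - y‖))

/-- The `k`-th receiver of the `i`-th transmitter is covered: in at least one of the time slots
`1, …, τ` its ratio for the signal of that transmitter reaches the detection threshold `T`. -/
def IsCovered (ℓ : ℝ → ℝ) (snrInv T : ℝ) (τ : ℕ) (X : ℕ → Ω → Plane) (C : ℕ → Ω → Cluster)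
    (F : ℕ × ℕ × ℕ × ℕ → Ω → ℝ) (i k : ℕ) (ω : Ω) : Prop :=
  ∃ n ∈ Finset.Icc 1 τ,
    ENNReal.ofReal T ≤
      sinr ℓ snrInv (fun j => X j ω) i ((C i ω).2 k) (fun j => F (i, k, j, n) ω)

open Classical in
/-- The number of covered receivers in the cluster of the `i`-th transmitter. -/
noncomputable def coveredCount (ℓ : ℝ → ℝ) (snrInv T : ℝ) (τ : ℕ) (X : ℕ → Ω → Plane)
    (C : ℕ → Ω → Cluster) (F : ℕ × ℕ × ℕ × ℕ → Ω → ℝ) (i : ℕ) (ω : Ω) : ℕ :=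
  ((Finset.range (C i ω).1).filter fun k => IsCovered ℓ snrInv T τ X C F i k ω).card

/-- The Palm expectation, relative to the point process `X` of intensity `lam` and evaluated with
the window `B`, of a functional whose value seen from the point `X i` is `f i`: the expected sum of
`f i` over the points `X i` in `B`, divided by the expected number `lam * |B|` of these points. -/
noncomputable def palmExpectation (P : Measure Ω) (X : ℕ → Ω → Plane) (lam : ℝ) (B : Set Plane)
    (f : ℕ → Ω → ℝ≥0∞) : ℝ≥0∞ :=
  (∫⁻ ω, ∑' i, ({ω | X i ω ∈ B} : Set Ω).indicator (f i) ω ∂P) /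
    (ENNReal.ofReal lam * volume B)

end Model

/-- `K(α, n) = (2π / α) ∫₀^∞ t ^ (-2/α - 1) (1 - (1 + t)⁻ⁿ) dt`. -/
noncomputable def K (α : ℝ) (n : ℕ) : ℝ :=
  2 * Real.pi / α * ∫ t in Set.Ioi (0 : ℝ), t ^ (-2 / α - 1) * (1 - 1 / (1 + t) ^ n)

end MulticastD2D

/-! Fix the transmitters and a receiver at y of the transmitter x_i, and put q = T ℓ(‖x_i - y‖). The
threshold is reached in a slot exactly when the signal fading is at least q times noise plus
interference. The exponential tail and the Laplace transform of the independent interferers' fading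
give the slot probability p = exp(-q SNR⁻¹) ∏_{j≠i} (1 + q/ℓ(‖x_j - y‖))⁻¹ (`fadingLaw_le_sinr`,
`slotProb`). Fading is independent between slots once the positions are fixed, so y is covered with
probability 1 - (1 - p)^τ, a signed sum of the moments p^n (`coverProb_eq`, `one_sub_one_sub_pow`).

By linearity, only the mean measure of a cluster enters: summing over receivers becomes integrating
y over the disc about x_i with density λ_r (`IsMulticastModel.lintegral_coveredCount`). It remains
to compute the expected sum, over transmitters in B, of ∫ p^n dy. Exchanging the integrals fixes y.
Inserting the missing factor j = i, which equals (1 + T)⁻ⁿ, and compensating by (1 + T)ⁿ makes p^n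
an exponential of a sum over all transmitters, with a parameter q that depends on x_i
(`slotProb_pow`).

For such functionals the Campbell-Mecke formula (`IsPoissonProcess.lintegral_tsum_mul_expNeg`)
replaces the sum by an integral over x times exp(-λ_m ∫ (1 - (1 + q/ℓ(‖z - y‖))⁻ⁿ) dz). In polar
coordinates, the substitution t = c s^(-α) evaluates the exponent as -λ_m K(α,n) T^(2/α) r²
(`integral_mul_one_sub`). The result depends only on r = ‖x - y‖, so integrating out x contributes
|B|, which the Palm normalisation cancels. The Mecke formula itself is proved from independent
Poisson counts: first for simple functions, then by limits in the integrands, and finally by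
approximating the parameter. -/

namespace MulticastD2D

open Filter Topology

/-! ### Exponential and logarithm on [0, ∞] -/

/-- The function `t ↦ exp (-t)` on `[0, ∞]`. -/
noncomputable def expNeg (t : ℝ≥0∞) : ℝ≥0∞ := EReal.exp (-(t : EReal))

/-- The function `t ↦ log (1 + t)` on `[0, ∞]`. -/
noncomputable def logOneAdd (t : ℝ≥0∞) : ℝ≥0∞ := (ENNReal.log (1 + t)).toENNReal

lemma expNeg_zero : expNeg 0 = 1 := by simp [expNeg]

lemma expNeg_top : expNeg ⊤ = 0 := by simp [expNeg]

lemma expNeg_ofReal {x : ℝ} (hx : 0 ≤ x) :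
    expNeg (ENNReal.ofReal x) = ENNReal.ofReal (Real.exp (-x)) := by
  rw [expNeg, EReal.coe_ennreal_ofReal, max_eq_left hx, ← EReal.coe_neg, EReal.exp_coe]

lemma expNeg_add (s t : ℝ≥0∞) : expNeg (s + t) = expNeg s * expNeg t := by
  induction s with
  | top => simp [expNeg_top]
  | coe s =>
    induction t with
    | top => simp [expNeg_top]
    | coe t =>
      rw [← ENNReal.coe_add]
      simp only [← ENNReal.ofReal_coe_nnreal]
      rw [expNeg_ofReal (by positivity), expNeg_ofReal (by positivity),
        expNeg_ofReal (by positivity), ← ENNReal.ofReal_mul (by positivity), ← Real.exp_add]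
      congr 2
      push_cast
      ring

lemma continuous_expNeg : Continuous expNeg :=
  ENNReal.continuous_exp.comp (continuous_neg.comp continuous_coe_ennreal_ereal)

@[fun_prop]
lemma measurable_expNeg : Measurable expNeg := continuous_expNeg.measurable

lemma expNeg_antitone : Antitone expNeg := fun _ _ h =>
  EReal.exp_monotone (EReal.neg_le_neg_iff.2 (EReal.coe_ennreal_le_coe_ennreal_iff.2 h))

lemma expNeg_le_one (t : ℝ≥0∞) : expNeg t ≤ 1 := by
  simpa [expNeg_zero] using expNeg_antitone (zero_le (a := t))

lemma expNeg_ne_top (t : ℝ≥0∞) : expNeg t ≠ ⊤ := ((expNeg_le_one t).trans_lt ENNReal.one_lt_top).ne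

lemma expNeg_sum {ι : Type*} (s : Finset ι) (f : ι → ℝ≥0∞) :
    expNeg (∑ i ∈ s, f i) = ∏ i ∈ s, expNeg (f i) := by
  classical
  induction s using Finset.induction_on with
  | empty => simp [expNeg_zero]
  | insert a s ha ih => rw [Finset.sum_insert ha, Finset.prod_insert ha, expNeg_add, ih]

lemma expNeg_natCast_mul (n : ℕ) (t : ℝ≥0∞) : expNeg (n * t) = expNeg t ^ n := by
  have := expNeg_sum (Finset.range n) fun _ => t
  simpa using this

lemma tendsto_prod_expNeg (f : ℕ → ℝ≥0∞) :
    Tendsto (fun n => ∏ i ∈ Finset.range n, expNeg (f i)) atTop (𝓝 (expNeg (∑' i, f i))) := by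
  simp_rw [← expNeg_sum]
  exact (continuous_expNeg.tendsto _).comp (ENNReal.tendsto_nat_tsum f)

lemma measurable_logOneAdd : Measurable logOneAdd :=
  (ENNReal.measurable_log.comp (measurable_const.add measurable_id)).ereal_toENNReal

/-- Turns infinite products of Laplace factors (1 + c_j)⁻¹ into `expNeg` of a sum, with infinite c_j
allowed. The truncation in `logOneAdd` is harmless because 1 + t ≥ 1. -/
lemma expNeg_logOneAdd (t : ℝ≥0∞) : expNeg (logOneAdd t) = (1 + t)⁻¹ := by
  rw [expNeg, logOneAdd, EReal.coe_toENNReal, EReal.exp_neg, ENNReal.exp_log]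
  simp

lemma logOneAdd_zero : logOneAdd 0 = 0 := by simp [logOneAdd]

lemma logOneAdd_monotone : Monotone logOneAdd := fun _ _ h =>
  EReal.toENNReal_le_toENNReal (ENNReal.log_monotone (by gcongr))

lemma continuous_logOneAdd : Continuous logOneAdd :=
  EReal.continuous_toENNReal.comp (ENNReal.continuous_log.comp (by fun_prop))

/-! ### Campbell-Mecke formula for a Poisson process -/

section Poisson

lemma lintegral_pointMeasure {Ω : Type*} {X : ℕ → Ω → Plane} {f : Plane → ℝ≥0∞} (hf : Measurable f) (ω : Ω) :
    ∫⁻ x, f x ∂(pointMeasure X ω) = ∑' i, f (X i ω) := by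
  simp [pointMeasure, lintegral_sum_measure, lintegral_dirac' _ hf]

variable {Ω : Type*} [MeasurableSpace Ω]

lemma measurable_lintegral_pointMeasure {X : ℕ → Ω → Plane} (hX : ∀ i, Measurable (X i))
    {f : Plane → ℝ≥0∞} (hf : Measurable f) :
    Measurable fun ω => ∫⁻ x, f x ∂(pointMeasure X ω) := by
  simp_rw [lintegral_pointMeasure hf]
  exact Measurable.tsum fun i => hf.comp (hX i)

lemma measurable_pointMeasure_apply {X : ℕ → Ω → Plane} (hX : ∀ i, Measurable (X i))
    {A : Set Plane} (hA : MeasurableSet A) : Measurable fun ω => pointMeasure X ω A := by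
  simpa [lintegral_indicator hA] using
    measurable_lintegral_pointMeasure hX (f := A.indicator 1) (measurable_one.indicator hA)

/-- The weights of the Poisson distribution. -/
noncomputable def poissonWeight (r : ℝ≥0) (k : ℕ) : ℝ≥0∞ :=
  ENNReal.ofReal (Real.exp (-r) * r ^ k / k.factorial)

lemma succ_mul_poissonWeight_succ (r : ℝ≥0) (k : ℕ) :
    ((k + 1 : ℕ) : ℝ≥0∞) * poissonWeight r (k + 1) = r * poissonWeight r k := by
  rw [poissonWeight, poissonWeight, ← ENNReal.ofReal_natCast, ← ENNReal.ofReal_coe_nnreal,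
    ← ENNReal.ofReal_mul (by positivity), ← ENNReal.ofReal_mul (by positivity)]
  congr 1
  rw [Nat.factorial_succ]
  push_cast
  field_simp
  ring

lemma tsum_poissonWeight_mul_pow (r : ℝ≥0) (q : ℝ≥0∞) :
    ∑' k : ℕ, poissonWeight r k * expNeg q ^ k = expNeg (r * (1 - expNeg q)) := by
  obtain ⟨t, ht⟩ : ∃ t : ℝ≥0, expNeg q = t := ⟨_, (ENNReal.coe_toNNReal (expNeg_ne_top q)).symm⟩
  have ht1 : (t : ℝ) ≤ 1 := by
    have := expNeg_le_one q
    rw [ht] at this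
    exact_mod_cast this
  rw [ht]
  have h1 : (r : ℝ≥0∞) * (1 - t) = ENNReal.ofReal (r * (1 - t)) := by
    rw [ENNReal.ofReal_mul (by positivity), ENNReal.ofReal_sub _ (by positivity)]
    simp
  rw [h1, expNeg_ofReal (mul_nonneg r.coe_nonneg (by linarith))]
  have h2 : ∀ k, poissonWeight r k * (t : ℝ≥0∞) ^ k =
      ENNReal.ofReal (Real.exp (-r) * ((r * t : ℝ) ^ k / k.factorial)) := by
    intro k
    rw [poissonWeight, ← ENNReal.ofReal_coe_nnreal (p := t), ← ENNReal.ofReal_pow (by positivity),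
      ← ENNReal.ofReal_mul (by positivity)]
    congr 1
    ring
  simp_rw [h2]
  have h3 : HasSum (fun k : ℕ => (r * t : ℝ) ^ k / k.factorial) (Real.exp (r * t)) := by
    rw [Real.exp_eq_exp_ℝ]
    exact NormedSpace.expSeries_div_hasSum_exp (r * t : ℝ)
  rw [← ENNReal.ofReal_tsum_of_nonneg (fun k => by positivity) (h3.summable.mul_left _),
    (h3.mul_left _).tsum_eq, ← Real.exp_add]
  congr 2
  ring

/-- Size biasing shifts a Poisson law by one: k w_k = r w_{k-1}. The extra point is the source of
the factor `expNeg q`, and of the self term in the Mecke formula. -/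
lemma tsum_natCast_mul_poissonWeight_mul_pow (r : ℝ≥0) (q : ℝ≥0∞) :
    ∑' k : ℕ, poissonWeight r k * (k * expNeg q ^ k) =
      r * expNeg q * expNeg (r * (1 - expNeg q)) := by
  rw [tsum_eq_zero_add' ENNReal.summable, ← tsum_poissonWeight_mul_pow, ← ENNReal.tsum_mul_left]
  simp only [Nat.cast_zero, zero_mul, mul_zero, zero_add]
  refine tsum_congr fun k => ?_
  calc _ = ((k + 1 : ℕ) : ℝ≥0∞) * poissonWeight r (k + 1) * expNeg q ^ (k + 1) := by ring
    _ = _ := by rw [succ_mul_poissonWeight_succ]; ring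

variable {P : Measure Ω} {X : ℕ → Ω → Plane} {μ : Measure Plane}

lemma IsPoissonProcess.lintegral_count [IsProbabilityMeasure P] (hX : IsPoissonProcess P X μ) {A : Set Plane}
    (hA : MeasurableSet A) (hμA : μ A ≠ ⊤) (g : ℝ≥0∞ → ℝ≥0∞) :
    ∫⁻ ω, g (pointMeasure X ω A) ∂P = ∑' k : ℕ, poissonWeight (μ A).toNNReal k * g k := by
  have hN := measurable_pointMeasure_apply hX.measurable hA
  have hm : ∀ k : ℕ, MeasurableSet {ω | pointMeasure X ω A = (k : ℝ≥0∞)} := fun k =>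
    hN (measurableSet_singleton _)
  have hd : Pairwise (Function.onFun Disjoint
      fun k : ℕ => {ω | pointMeasure X ω A = (k : ℝ≥0∞)}) := by
    intro k l hkl
    refine Set.disjoint_left.2 fun ω hk hl => hkl ?_
    simp only [Set.mem_ofPred_eq] at hk hl
    exact_mod_cast hk.symm.trans hl
  have hP : ∀ k : ℕ, P {ω | pointMeasure X ω A = (k : ℝ≥0∞)} = poissonWeight (μ A).toNNReal k :=
    fun k => by rw [hX.count_law A hA hμA k, poissonMeasure_singleton, poissonWeight]
  -- The Poisson weights sum to 1 (generating function at q = 0), so the count is almost surely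
  -- finite.
  have hfull : P (⋃ k : ℕ, {ω | pointMeasure X ω A = (k : ℝ≥0∞)}) = 1 := by
    rw [measure_iUnion hd hm]
    simp_rw [hP]
    simpa [expNeg_zero] using tsum_poissonWeight_mul_pow (μ A).toNNReal 0
  have hae : ∀ᵐ ω ∂P, ω ∈ ⋃ k : ℕ, {ω | pointMeasure X ω A = (k : ℝ≥0∞)} :=
    (prob_compl_eq_zero_iff (MeasurableSet.iUnion hm)).2 hfull
  rw [← Measure.restrict_eq_self_of_ae_mem hae, lintegral_iUnion hm hd]
  refine tsum_congr fun k => ?_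
  rw [setLIntegral_congr_fun (g := fun _ => g k) (hm k) (fun ω hω => by
    simp only [Set.mem_ofPred_eq] at hω; simp [hω]), setLIntegral_const, hP, mul_comm]

lemma IsPoissonProcess.iIndepFun_count (hX : IsPoissonProcess P X μ) {β : Type*} (S : Finset β)
    {A : β → Set Plane} (hA : ∀ a, MeasurableSet (A a))
    (hd : ∀ a b, a ≠ b → Disjoint (A a) (A b)) :
    iIndepFun (fun (a : S) ω => pointMeasure X ω (A a)) P := by
  have h := hX.count_indep S.card (fun k => A (S.equivFin.symm k)) (fun _ => hA _)
    (fun a b hab => hd _ _ fun h => hab (S.equivFin.symm.injective (Subtype.ext h)))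
  simpa using h.precomp S.equivFin.injective

variable [IsProbabilityMeasure P]

/-- The Mecke formula on finitely many disjoint cells. Independence factorises the mean; the cell
`a` contributes a size-biased Poisson sum, the others the plain generating function. -/
lemma IsPoissonProcess.lintegral_count_mul_expNeg (hX : IsPoissonProcess P X μ) {β : Type*}
    (S : Finset β) {A : β → Set Plane} (hA : ∀ a, MeasurableSet (A a))
    (hd : ∀ a b, a ≠ b → Disjoint (A a) (A b)) (hμ : ∀ a ∈ S, μ (A a) ≠ ⊤) (q : β → ℝ≥0∞)
    {a : β} (ha : a ∈ S) :
    ∫⁻ ω, pointMeasure X ω (A a) * expNeg (∑ c ∈ S, q c * pointMeasure X ω (A c)) ∂P =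
      μ (A a) * expNeg (q a) * expNeg (∑ c ∈ S, μ (A c) * (1 - expNeg (q c))) := by
  classical
  let g : S → ℝ≥0∞ → ℝ≥0∞ := fun c t => (if (c : β) = a then t else 1) * expNeg (q c * t)
  have hg : ∀ c, Measurable (g c) := by
    intro c
    by_cases h : (c : β) = a <;> simp only [g, h, if_true, if_false] <;> fun_prop
  have hind := (hX.iIndepFun_count S hA hd).comp g hg
  have hprod := lintegral_prod_eq_prod_lintegral_of_indepFun Finset.univ _ hind
    (fun c => (hg c).comp (measurable_pointMeasure_apply hX.measurable (hA c)))
  have h1 : ∀ f : S → ℝ≥0∞, ∏ c : S, (if (c : β) = a then f c else 1) = f ⟨a, ha⟩ := by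
    intro f
    rw [Finset.prod_eq_single ⟨a, ha⟩]
    · simp
    · intro b _ hb
      rw [if_neg fun h => hb (Subtype.ext h)]
    · simp
  have h2 : ∀ c : S, ∫⁻ ω, (g c ∘ fun ω => pointMeasure X ω (A c)) ω ∂P =
      (if (c : β) = a then μ (A c) * expNeg (q c) else 1) *
        expNeg (μ (A c) * (1 - expNeg (q c))) := by
    intro c
    have hc := hμ c c.2
    simp only [Function.comp_apply]
    rw [hX.lintegral_count (hA c) hc]
    by_cases h : (c : β) = a
    · simp only [g, h, if_true]
      rw [h] at hc
      have := tsum_natCast_mul_poissonWeight_mul_pow (μ (A a)).toNNReal (q a)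
      rw [ENNReal.coe_toNNReal hc] at this
      rw [← this]
      simp_rw [mul_comm (q a), expNeg_natCast_mul]
    · simp only [g, h, if_false, one_mul]
      have := tsum_poissonWeight_mul_pow (μ (A c)).toNNReal (q c)
      rw [ENNReal.coe_toNNReal hc] at this
      rw [← this]
      simp_rw [mul_comm (q c), expNeg_natCast_mul]
  simp_rw [h2] at hprod
  simp only [Function.comp_apply, g, Finset.prod_mul_distrib] at hprod
  rw [h1] at hprod
  simp_rw [fun ω => h1 fun c => pointMeasure X ω (A c)] at hprod
  simp only [expNeg_sum]
  simp only [← Finset.prod_coe_sort S]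
  exact hprod

/-- The level set of 0 is dropped because it may have infinite intensity, where no Poisson law is
available. -/
lemma lintegral_comp_simpleFunc_eq_sum_erase {α β : Type*} [MeasurableSpace α] [Zero β]
    [DecidableEq β] (s : SimpleFunc α β) (g : β → ℝ≥0∞) (hg : g 0 = 0) (ν : Measure α) :
    ∫⁻ x, g (s x) ∂ν = ∑ a ∈ s.range.erase 0, g a * ν (s ⁻¹' {a}) := by
  rw [Finset.sum_erase _ (by simp [hg]), ← SimpleFunc.map_lintegral,
    ← SimpleFunc.lintegral_eq_lintegral]
  rfl

/-- The linear and the exponential integrand are the two components of one simple function, so that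
both are constant on the same disjoint cells. -/
lemma IsPoissonProcess.lintegral_simpleFunc (hX : IsPoissonProcess P X μ)
    (s : SimpleFunc Plane (ℝ≥0∞ × ℝ≥0∞)) (hs : ∀ a, a ≠ 0 → μ (s ⁻¹' {a}) ≠ ⊤) :
    ∫⁻ ω, (∫⁻ x, (s x).1 ∂(pointMeasure X ω)) *
        expNeg (∫⁻ x, (s x).2 ∂(pointMeasure X ω)) ∂P =
      (∫⁻ x, (s x).1 * expNeg (s x).2 ∂μ) * expNeg (∫⁻ x, (1 - expNeg (s x).2) ∂μ) := by
  classical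
  simp_rw [lintegral_comp_simpleFunc_eq_sum_erase s Prod.fst rfl,
    lintegral_comp_simpleFunc_eq_sum_erase s Prod.snd rfl]
  rw [lintegral_comp_simpleFunc_eq_sum_erase s (fun a => a.1 * expNeg a.2) (by simp),
    lintegral_comp_simpleFunc_eq_sum_erase s (fun a => 1 - expNeg a.2) (by simp [expNeg_zero])]
  simp_rw [Finset.sum_mul]
  have hm : ∀ a, MeasurableSet (s ⁻¹' {a}) := fun a => s.measurableSet_preimage _
  rw [lintegral_finsetSum']
  · refine Finset.sum_congr rfl fun a ha => ?_
    simp_rw [mul_assoc]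
    rw [lintegral_const_mul, hX.lintegral_count_mul_expNeg _ hm _ _ _ ha]
    · simp_rw [mul_comm (μ _) (1 - _)]
      ring
    · intro a b hab
      exact Set.disjoint_left.2 fun x h1 h2 => hab (h1.symm.trans h2)
    · exact fun a ha => hs a (Finset.ne_of_mem_erase ha)
    · have := fun a => measurable_pointMeasure_apply hX.measurable (hm a)
      fun_prop
  · intro a _
    have := fun a => measurable_pointMeasure_apply hX.measurable (hm a)
    fun_prop

/-- An increasing sequence of simple functions with values and supports of finite measure. -/
noncomputable def finApprox (μ : Measure Plane) [SigmaFinite μ] (f : Plane → ℝ≥0∞) (m : ℕ) :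
    SimpleFunc Plane ℝ≥0∞ :=
  (SimpleFunc.eapprox f m).restrict (spanningSets μ m)

section Approx

variable (μ) [SigmaFinite μ]

lemma finApprox_apply (f : Plane → ℝ≥0∞) (m : ℕ) (x : Plane) :
    finApprox μ f m x = (spanningSets μ m).indicator (SimpleFunc.eapprox f m) x := by
  rw [finApprox, SimpleFunc.restrict_apply _ (measurableSet_spanningSets μ m)]

lemma finApprox_mono (f : Plane → ℝ≥0∞) (x : Plane) : Monotone fun m => finApprox μ f m x := by
  intro m n hmn
  simp only [finApprox_apply]
  refine (Set.indicator_le_indicator_of_subset (monotone_spanningSets μ hmn)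
    (fun _ => zero_le) x).trans ?_
  exact Set.indicator_le_indicator (SimpleFunc.monotone_eapprox f hmn x)

lemma tendsto_finApprox {f : Plane → ℝ≥0∞} (hf : Measurable f) (x : Plane) :
    Tendsto (fun m => finApprox μ f m x) atTop (𝓝 (f x)) := by
  refine (SimpleFunc.tendsto_eapprox hf x).congr' ?_
  filter_upwards [eventually_ge_atTop (spanningSetsIndex μ x)] with m hm
  rw [finApprox_apply, Set.indicator_of_mem (mem_spanningSets_of_index_le μ x hm)]

lemma finApprox_lt_top (f : Plane → ℝ≥0∞) (m : ℕ) (x : Plane) : finApprox μ f m x < ⊤ := by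
  rw [finApprox_apply]
  by_cases h : x ∈ spanningSets μ m
  · rw [Set.indicator_of_mem h]
    exact SimpleFunc.eapprox_lt_top f m x
  · simp [Set.indicator_of_notMem h]

lemma finApprox_eq_zero (f : Plane → ℝ≥0∞) (m : ℕ) {x : Plane} (hx : x ∉ spanningSets μ m) :
    finApprox μ f m x = 0 := by
  rw [finApprox_apply, Set.indicator_of_notMem hx]

lemma lintegral_finApprox_ne_top (f : Plane → ℝ≥0∞) (m : ℕ) : ∫⁻ x, finApprox μ f m x ∂μ ≠ ⊤ := by
  rw [SimpleFunc.lintegral_eq_lintegral]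
  refine (SimpleFunc.FinMeasSupp.lintegral_lt_top ?_
    (Eventually.of_forall fun x => (finApprox_lt_top μ f m x).ne)).ne
  rw [SimpleFunc.finMeasSupp_iff_support]
  refine (measure_mono fun x hx => ?_).trans_lt (measure_spanningSets_lt_top μ m)
  by_contra h
  exact hx (finApprox_eq_zero μ f m h)

end Approx

lemma tendsto_expNeg_lintegral {α : Type*} [MeasurableSpace α] (ν : Measure α)
    {f : ℕ → α → ℝ≥0∞} {g : α → ℝ≥0∞} (hf : ∀ n, Measurable (f n))
    (hmono : ∀ x, Monotone fun n => f n x) (hlim : ∀ x, Tendsto (fun n => f n x) atTop (𝓝 (g x))) :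
    Tendsto (fun n => expNeg (∫⁻ x, f n x ∂ν)) atTop (𝓝 (expNeg (∫⁻ x, g x ∂ν))) :=
  (continuous_expNeg.tendsto _).comp (lintegral_tendsto_of_tendsto_of_monotone
    (fun n => (hf n).aemeasurable) (.of_forall hmono) (.of_forall hlim))

lemma IsPoissonProcess.lintegral_finApprox [SigmaFinite μ] (hX : IsPoissonProcess P X μ)
    (v u : Plane → ℝ≥0∞) (m n : ℕ) :
    ∫⁻ ω, (∫⁻ x, finApprox μ v m x ∂(pointMeasure X ω)) *
        expNeg (∫⁻ x, finApprox μ u n x ∂(pointMeasure X ω)) ∂P =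
      (∫⁻ x, finApprox μ v m x * expNeg (finApprox μ u n x) ∂μ) *
        expNeg (∫⁻ x, (1 - expNeg (finApprox μ u n x)) ∂μ) := by
  refine hX.lintegral_simpleFunc ((finApprox μ v m).pair (finApprox μ u n)) fun a ha => ?_
  refine ((measure_mono fun x hx => ?_).trans_lt (measure_spanningSets_lt_top μ (max m n))).ne
  by_contra h
  refine ha ?_
  rw [← (show _ = a from hx), SimpleFunc.pair_apply,
    finApprox_eq_zero μ v m fun h' => h (monotone_spanningSets μ (le_max_left _ _) h'),
    finApprox_eq_zero μ u n fun h' => h (monotone_spanningSets μ (le_max_right _ _) h')]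
  rfl

lemma monotone_one_sub_expNeg : Monotone fun t => 1 - expNeg t :=
  fun _ _ h => tsub_le_tsub_left (expNeg_antitone h) 1

lemma continuous_one_sub_expNeg : Continuous fun t => 1 - expNeg t :=
  continuous_iff_continuousAt.2 fun _ =>
    ENNReal.Tendsto.sub tendsto_const_nhds continuous_expNeg.continuousAt (Or.inl ENNReal.one_ne_top)

/-- The Campbell-Mecke formula for products of linear and exponential functionals. -/
theorem IsPoissonProcess.lintegral_mul_expNeg [SigmaFinite μ] (hX : IsPoissonProcess P X μ)
    {v u : Plane → ℝ≥0∞} (hv : Measurable v) (hu : Measurable u) :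
    ∫⁻ ω, (∫⁻ x, v x ∂(pointMeasure X ω)) * expNeg (∫⁻ x, u x ∂(pointMeasure X ω)) ∂P =
      (∫⁻ x, v x * expNeg (u x) ∂μ) * expNeg (∫⁻ x, (1 - expNeg (u x)) ∂μ) := by
  have hfm := fun (f : Plane → ℝ≥0∞) m =>
    measurable_lintegral_pointMeasure hX.measurable (finApprox μ f m).measurable
  -- As `u` is approximated from below the exponential decreases, so the limit in `u` needs an
  -- integrable bound. The mean is the case `u = 0` of the simple formula. Only afterwards is `v`
  -- approximated, by monotone convergence.
  have hmean : ∀ m, ∫⁻ ω, ∫⁻ x, finApprox μ v m x ∂(pointMeasure X ω) ∂P ≠ ⊤ := by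
    intro m
    have h := hX.lintegral_simpleFunc ((finApprox μ v m).pair 0) fun a ha => by
      refine ((measure_mono fun x hx => ?_).trans_lt (measure_spanningSets_lt_top μ m)).ne
      by_contra h
      refine ha ?_
      rw [← (show _ = a from hx), SimpleFunc.pair_apply, finApprox_eq_zero μ v m h]
      rfl
    simp only [SimpleFunc.pair_apply, SimpleFunc.coe_zero, Pi.zero_apply, lintegral_zero,
      expNeg_zero, mul_one, tsub_self] at h
    rw [h]
    exact lintegral_finApprox_ne_top μ v m
  have hstep : ∀ m, ∫⁻ ω, (∫⁻ x, finApprox μ v m x ∂(pointMeasure X ω)) *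
        expNeg (∫⁻ x, u x ∂(pointMeasure X ω)) ∂P =
      (∫⁻ x, finApprox μ v m x * expNeg (u x) ∂μ) * expNeg (∫⁻ x, (1 - expNeg (u x)) ∂μ) := by
    intro m
    have hlhs : Tendsto (fun n => ∫⁻ ω, (∫⁻ x, finApprox μ v m x ∂(pointMeasure X ω)) *
        expNeg (∫⁻ x, finApprox μ u n x ∂(pointMeasure X ω)) ∂P) atTop
        (𝓝 (∫⁻ ω, (∫⁻ x, finApprox μ v m x ∂(pointMeasure X ω)) *
          expNeg (∫⁻ x, u x ∂(pointMeasure X ω)) ∂P)) := by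
      refine tendsto_lintegral_of_dominated_convergence _
        (fun n => (hfm v m).mul (measurable_expNeg.comp (hfm u n)))
        (fun n => .of_forall fun ω => mul_le_of_le_one_right' (expNeg_le_one _)) (hmean m) ?_
      filter_upwards [ae_lt_top (hfm v m) (hmean m)] with ω hω
      exact ENNReal.Tendsto.const_mul (tendsto_expNeg_lintegral _
        (fun n => (finApprox μ u n).measurable) (finApprox_mono μ u) (tendsto_finApprox μ hu))
        (Or.inr hω.ne)
    have hrhs : Tendsto (fun n => (∫⁻ x, finApprox μ v m x * expNeg (finApprox μ u n x) ∂μ) *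
        expNeg (∫⁻ x, (1 - expNeg (finApprox μ u n x)) ∂μ)) atTop
        (𝓝 ((∫⁻ x, finApprox μ v m x * expNeg (u x) ∂μ) *
          expNeg (∫⁻ x, (1 - expNeg (u x)) ∂μ))) := by
      refine ENNReal.Tendsto.mul ?_ (Or.inr (expNeg_ne_top _)) ?_ (Or.inr ?_)
      · refine tendsto_lintegral_of_dominated_convergence _
          (fun n => (finApprox μ v m).measurable.mul
            (measurable_expNeg.comp (finApprox μ u n).measurable))
          (fun n => .of_forall fun ω => mul_le_of_le_one_right' (expNeg_le_one _))
          (lintegral_finApprox_ne_top μ v m) (.of_forall fun x => ?_)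
        exact ENNReal.Tendsto.const_mul ((continuous_expNeg.tendsto _).comp
          (tendsto_finApprox μ hu x)) (Or.inr (finApprox_lt_top μ v m x).ne)
      · exact tendsto_expNeg_lintegral _ (fun n => continuous_one_sub_expNeg.measurable.comp
          (finApprox μ u n).measurable) (fun x => monotone_one_sub_expNeg.comp (finApprox_mono μ u x))
          fun x => (continuous_one_sub_expNeg.tendsto _).comp (tendsto_finApprox μ hu x)
      · exact ((lintegral_mono fun x => mul_le_of_le_one_right' (expNeg_le_one _)).trans_lt
          (lintegral_finApprox_ne_top μ v m).lt_top).ne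
    refine tendsto_nhds_unique hlhs (hrhs.congr fun n => (hX.lintegral_finApprox v u m n).symm)
  have hum := measurable_lintegral_pointMeasure hX.measurable hu
  have hlhs : Tendsto (fun m => ∫⁻ ω, (∫⁻ x, finApprox μ v m x ∂(pointMeasure X ω)) *
      expNeg (∫⁻ x, u x ∂(pointMeasure X ω)) ∂P) atTop
      (𝓝 (∫⁻ ω, (∫⁻ x, v x ∂(pointMeasure X ω)) *
        expNeg (∫⁻ x, u x ∂(pointMeasure X ω)) ∂P)) := by
    refine lintegral_tendsto_of_tendsto_of_monotone
      (fun m => ((hfm v m).mul (measurable_expNeg.comp hum)).aemeasurable)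
      (.of_forall fun ω m n hmn => ?_) (.of_forall fun ω => ?_)
    · exact mul_le_mul_left (lintegral_mono fun x => finApprox_mono μ v x hmn) _
    · exact ENNReal.Tendsto.mul_const (lintegral_tendsto_of_tendsto_of_monotone
        (fun n => (finApprox μ v n).measurable.aemeasurable) (.of_forall (finApprox_mono μ v))
        (.of_forall (tendsto_finApprox μ hv))) (Or.inr (expNeg_ne_top _))
  refine tendsto_nhds_unique hlhs (Tendsto.congr (fun m => (hstep m).symm)
    (ENNReal.Tendsto.mul_const ?_ (Or.inr (expNeg_ne_top _))))
  refine lintegral_tendsto_of_tendsto_of_monotone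
    (fun m => ((finApprox μ v m).measurable.mul (measurable_expNeg.comp hu)).aemeasurable)
    (.of_forall fun x m n hmn => ?_) (.of_forall fun x => ?_)
  · exact mul_le_mul_left (finApprox_mono μ v x hmn) _
  · exact ENNReal.Tendsto.mul_const (tendsto_finApprox μ hv x) (Or.inr (expNeg_ne_top _))

end Poisson

/-! ### Campbell-Mecke formula with a parameter depending on the point -/

section PoissonParam

variable {Ω : Type*} [MeasurableSpace Ω] {P : Measure Ω} [IsProbabilityMeasure P]
  {X : ℕ → Ω → Plane} {μ : Measure Plane} [SigmaFinite μ]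

lemma IsPoissonProcess.lintegral_tsum (hX : IsPoissonProcess P X μ)
    {v : Plane → ℝ≥0∞} (hv : Measurable v) :
    ∫⁻ ω, ∑' i, v (X i ω) ∂P = ∫⁻ x, v x ∂μ := by
  simpa [expNeg_zero, lintegral_pointMeasure hv] using
    hX.lintegral_mul_expNeg hv (u := fun _ => 0) measurable_const

/-- A parameter with finitely many values splits `v` along its level sets, on each of which the
exponent is a fixed function. -/
lemma IsPoissonProcess.lintegral_tsum_mul_expNeg_simpleFunc (hX : IsPoissonProcess P X μ)
    {v : Plane → ℝ≥0∞} (hv : Measurable v) (s : SimpleFunc Plane ℝ≥0∞)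
    {U : ℝ≥0∞ → Plane → ℝ≥0∞} (hU : ∀ q, Measurable (U q)) :
    ∫⁻ ω, ∑' i, v (X i ω) * expNeg (∑' j, U (s (X i ω)) (X j ω)) ∂P =
      ∫⁻ x, v x * expNeg (U (s x) x) * expNeg (∫⁻ z, (1 - expNeg (U (s x) z)) ∂μ) ∂μ := by
  classical
  have key : ∀ (G : ℝ≥0∞ → ℝ≥0∞) (x : Plane),
      v x * G (s x) = ∑ q ∈ s.range, (s ⁻¹' {q}).indicator v x * G q := by
    intro G x
    rw [Finset.sum_eq_single (s x)]
    · simp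
    · intro q _ hq
      have hx : x ∉ s ⁻¹' {q} := fun h => hq (show s x = q from h).symm
      rw [Set.indicator_of_notMem hx, zero_mul]
    · exact fun h => absurd (s.mem_range_self x) h
  have hm : ∀ q, Measurable ((s ⁻¹' {q}).indicator v) := fun q =>
    hv.indicator (s.measurableSet_preimage _)
  have hX' := hX.measurable
  have hsum : ∀ q, Measurable fun ω => ∑' j, U q (X j ω) := fun q =>
    Measurable.tsum fun j => (hU q).comp (hX' j)
  have hl : ∀ ω, ∑' i, v (X i ω) * expNeg (∑' j, U (s (X i ω)) (X j ω)) =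
      ∑ q ∈ s.range, (∑' i, (s ⁻¹' {q}).indicator v (X i ω)) * expNeg (∑' j, U q (X j ω)) := by
    intro ω
    simp_rw [fun i => key (fun q => expNeg (∑' j, U q (X j ω))) (X i ω)]
    rw [Summable.tsum_finsetSum fun _ _ => ENNReal.summable]
    simp_rw [ENNReal.tsum_mul_right]
  simp_rw [hl]
  have hmeas : ∀ q, Measurable fun ω =>
      (∑' i, (s ⁻¹' {q}).indicator v (X i ω)) * expNeg (∑' j, U q (X j ω)) := fun q =>
    (Measurable.tsum fun j => (hm q).comp (hX' j)).mul (measurable_expNeg.comp (hsum q))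
  rw [lintegral_finsetSum _ fun q _ => hmeas q]
  have hr : ∀ q, ∫⁻ ω, (∑' i, (s ⁻¹' {q}).indicator v (X i ω)) * expNeg (∑' j, U q (X j ω)) ∂P =
      ∫⁻ x, (s ⁻¹' {q}).indicator v x * expNeg (U q x) *
        expNeg (∫⁻ z, (1 - expNeg (U q z)) ∂μ) ∂μ := by
    intro q
    have := hX.lintegral_mul_expNeg (hm q) (hU q)
    simp_rw [lintegral_pointMeasure (hm q), lintegral_pointMeasure (hU q)] at this
    rw [this, lintegral_mul_const]
    exact (hm q).mul (measurable_expNeg.comp (hU q))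
  simp_rw [hr]
  rw [← lintegral_finsetSum]
  · refine lintegral_congr fun x => ?_
    simp_rw [mul_assoc]
    exact (key (fun q => expNeg (U q x) * expNeg (∫⁻ z, (1 - expNeg (U q z)) ∂μ)) x).symm
  · exact fun q _ => ((hm q).mul (measurable_expNeg.comp (hU q))).mul_const _

/-- The Campbell-Mecke formula for an exponential functional whose exponent depends on the marked
point through a parameter. -/
theorem IsPoissonProcess.lintegral_tsum_mul_expNeg (hX : IsPoissonProcess P X μ)
    {v θ : Plane → ℝ≥0∞} (hv : Measurable v) (hvμ : ∫⁻ x, v x ∂μ ≠ ⊤) (hθ : Measurable θ)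
    {U : ℝ≥0∞ → Plane → ℝ≥0∞} (hU : ∀ q, Measurable (U q)) (hmono : ∀ z, Monotone fun q => U q z)
    (hlim : ∀ z (q : ℕ → ℝ≥0∞) (q' : ℝ≥0∞), Monotone q → Tendsto q atTop (𝓝 q') →
      Tendsto (fun n => U (q n) z) atTop (𝓝 (U q' z))) :
    ∫⁻ ω, ∑' i, v (X i ω) * expNeg (∑' j, U (θ (X i ω)) (X j ω)) ∂P =
      ∫⁻ x, v x * expNeg (U (θ x) x) * expNeg (∫⁻ z, (1 - expNeg (U (θ x) z)) ∂μ) ∂μ := by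
  have hX' := hX.measurable
  let s := SimpleFunc.eapprox θ
  have hs : ∀ x, Monotone fun n => s n x := fun x m n hmn => SimpleFunc.monotone_eapprox θ hmn x
  have hst : ∀ x z, Tendsto (fun n => U (s n x) z) atTop (𝓝 (U (θ x) z)) := fun x z =>
    hlim z _ _ (hs x) (SimpleFunc.tendsto_eapprox hθ x)
  have hsm : ∀ x z, Monotone fun n => U (s n x) z := fun x z => (hmono z).comp (hs x)
  have hle : ∀ (a : ℝ≥0∞) t, a * expNeg t ≤ a := fun a t => mul_le_of_le_one_right' (expNeg_le_one t)
  have hmean := hX.lintegral_tsum hv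
  have hlhs : Tendsto (fun n => ∫⁻ ω, ∑' i, v (X i ω) * expNeg (∑' j, U (s n (X i ω)) (X j ω)) ∂P)
      atTop (𝓝 (∫⁻ ω, ∑' i, v (X i ω) * expNeg (∑' j, U (θ (X i ω)) (X j ω)) ∂P)) := by
    have hvm : Measurable fun ω => ∑' i, v (X i ω) := Measurable.tsum fun i => hv.comp (hX' i)
    refine tendsto_lintegral_of_dominated_convergence (fun ω => ∑' i, v (X i ω)) (fun n => ?_)
      (fun n => .of_forall fun ω => ENNReal.tsum_le_tsum fun i => hle _ _) (hmean ▸ hvμ) ?_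
    · refine Measurable.tsum fun i => (hv.comp (hX' i)).mul (measurable_expNeg.comp ?_)
      refine Measurable.tsum fun j => ?_
      -- The parameter has finitely many values, so measurability for each fixed `q` suffices and
      -- `U` need not be jointly measurable.
      exact ((s n).comp (X i) (hX' i)).measurable_bind (fun q ω => U q (X j ω))
        fun q => (hU q).comp (hX' j)
    · filter_upwards [ae_lt_top hvm (hmean ▸ hvμ)] with ω hω
      -- Sums become integrals against counting measure: dominated convergence applies to the sum
      -- over i, monotone convergence to the exponent.
      simp only [fun f : ℕ → ℝ≥0∞ => (MeasureTheory.lintegral_count f).symm]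
      refine tendsto_lintegral_of_dominated_convergence (fun i => v (X i ω))
        (fun n => measurable_of_countable _) (fun n => .of_forall fun i => hle _ _)
        (by rw [MeasureTheory.lintegral_count]; exact hω.ne) (.of_forall fun i => ?_)
      refine ENNReal.Tendsto.const_mul (tendsto_expNeg_lintegral _
        (fun n => measurable_of_countable _) (fun j => hsm _ _) fun j => hst _ _)
        (Or.inr (ENNReal.ne_top_of_tsum_ne_top hω.ne i))
  have hrhs : Tendsto (fun n => ∫⁻ x, v x * expNeg (U (s n x) x) *
      expNeg (∫⁻ z, (1 - expNeg (U (s n x) z)) ∂μ) ∂μ) atTop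
      (𝓝 (∫⁻ x, v x * expNeg (U (θ x) x) * expNeg (∫⁻ z, (1 - expNeg (U (θ x) z)) ∂μ) ∂μ)) := by
    refine tendsto_lintegral_of_dominated_convergence v (fun n => ?_)
      (fun n => .of_forall fun x => (hle _ _).trans (hle _ _)) hvμ ?_
    · refine (s n).measurable_bind (fun q x => v x * expNeg (U q x) *
        expNeg (∫⁻ z, (1 - expNeg (U q z)) ∂μ)) fun q => ?_
      exact (hv.mul (measurable_expNeg.comp (hU q))).mul_const _
    · filter_upwards [ae_lt_top hv hvμ] with x hx
      refine ENNReal.Tendsto.mul (ENNReal.Tendsto.const_mul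
        ((continuous_expNeg.tendsto _).comp (hst x x)) (Or.inr hx.ne)) (Or.inr (expNeg_ne_top _))
        (tendsto_expNeg_lintegral _ (fun n => continuous_one_sub_expNeg.measurable.comp (hU _))
          (fun z => monotone_one_sub_expNeg.comp (hsm x z))
          fun z => (continuous_one_sub_expNeg.tendsto _).comp (hst x z))
        (Or.inr ((hle _ _).trans_lt hx).ne)
  exact tendsto_nhds_unique hlhs
    (hrhs.congr fun n => (hX.lintegral_tsum_mul_expNeg_simpleFunc hv (s n) hU).symm)

end PoissonParam

/-! ### Exponential fading and the success probability in one slot -/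

instance isProbabilityMeasure_expMeasure_one : IsProbabilityMeasure (expMeasure 1) :=
  isProbabilityMeasure_expMeasure one_pos

lemma expMeasure_Iic (x : ℝ) (hx : 0 ≤ x) :
    expMeasure 1 (Set.Iic x) = ENNReal.ofReal (1 - Real.exp (-x)) := by
  rw [← ofReal_cdf, cdf_expMeasure_eq one_pos, if_pos hx, one_mul]

lemma expMeasure_singleton (x : ℝ) : expMeasure 1 {x} = 0 := by
  rw [expMeasure, gammaMeasure]
  exact withDensity_absolutelyContinuous _ _ (measure_singleton x)

lemma expMeasure_ae_pos : ∀ᵐ x ∂(expMeasure 1), 0 < x := by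
  have h := expMeasure_Iic 0 le_rfl
  simp only [neg_zero, Real.exp_zero, sub_self, ENNReal.ofReal_zero] at h
  rw [ae_iff]
  simpa [Set.Iic] using h

lemma expMeasure_Ici (x : ℝ) (hx : 0 ≤ x) :
    expMeasure 1 (Set.Ici x) = ENNReal.ofReal (Real.exp (-x)) := by
  have h1 : expMeasure 1 (Set.Ici x) = expMeasure 1 (Set.Ioi x) := by
    refine le_antisymm ?_ (measure_mono Set.Ioi_subset_Ici_self)
    rw [← Set.Ioi_union_left]
    exact (measure_union_le _ _).trans (by rw [expMeasure_singleton, add_zero])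
  rw [h1, ← Set.compl_Iic, prob_compl_eq_one_sub measurableSet_Iic, expMeasure_Iic x hx,
    ← ENNReal.ofReal_one, ← ENNReal.ofReal_sub _
      (sub_nonneg.2 (Real.exp_le_one_iff.2 (by linarith)))]
  congr 1
  ring

/-- The exponential tail: it makes the threshold probability multiplicative in noise and
interference. -/
lemma expMeasure_le_ofReal (z : ℝ≥0∞) : expMeasure 1 {x | z ≤ ENNReal.ofReal x} = expNeg z := by
  induction z with
  | top => simp [expNeg_top]
  | coe z =>
    rcases eq_or_ne z 0 with rfl | hz
    · simp [expNeg_zero]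
    · have : {x : ℝ | (z : ℝ≥0∞) ≤ ENNReal.ofReal x} = Set.Ici (z : ℝ) := by
        ext x
        rw [Set.mem_ofPred_eq, Set.mem_Ici, ← ENNReal.ofReal_coe_nnreal,
          ENNReal.ofReal_le_ofReal_iff']
        have : 0 < (z : ℝ) := by positivity
        constructor
        · rintro (h | h)
          · exact h
          · linarith
        · exact Or.inl
      rw [this, expMeasure_Ici _ z.coe_nonneg, ← ENNReal.ofReal_coe_nnreal,
        expNeg_ofReal z.coe_nonneg]

/-- The Laplace transform of the exponential distribution. -/
lemma lintegral_expMeasure_expNeg_mul (c : ℝ≥0∞) :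
    ∫⁻ x, expNeg (c * ENNReal.ofReal x) ∂(expMeasure 1) = (1 + c)⁻¹ := by
  induction c with
  | top =>
    have : (fun x => expNeg (⊤ * ENNReal.ofReal x)) =ᵐ[expMeasure 1] fun _ => 0 := by
      filter_upwards [expMeasure_ae_pos] with x hx
      rw [ENNReal.top_mul (by simpa using hx), expNeg_top]
    rw [lintegral_congr_ae this]
    simp
  | coe c =>
    have hd : ∀ x, exponentialPDF 1 x * expNeg (c * ENNReal.ofReal x) =
        ENNReal.ofReal (1 + c)⁻¹ * exponentialPDF (1 + c) x := by
      intro x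
      rcases lt_or_ge x 0 with hx | hx
      · simp [exponentialPDF_of_neg hx]
      · rw [exponentialPDF_of_nonneg hx, exponentialPDF_of_nonneg hx,
          ← ENNReal.ofReal_coe_nnreal, ← ENNReal.ofReal_mul c.coe_nonneg,
          expNeg_ofReal (by positivity), ← ENNReal.ofReal_mul (by positivity),
          ← ENNReal.ofReal_mul (by positivity), one_mul, ← Real.exp_add, ← mul_assoc,
          inv_mul_cancel₀ (by positivity), one_mul]
        congr 2
        ring_nf
    have hm : Measurable fun x => expNeg (c * ENNReal.ofReal x) := by fun_prop
    have hpdf : ∀ r, Measurable (exponentialPDF r) := fun r =>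
      (measurable_exponentialPDFReal r).ennreal_ofReal
    have hexp : expMeasure 1 = volume.withDensity (exponentialPDF 1) := rfl
    rw [hexp, lintegral_withDensity_eq_lintegral_mul _ (hpdf 1) hm]
    simp only [Pi.mul_apply, hd]
    rw [lintegral_const_mul _ (hpdf _), lintegral_exponentialPDF_eq_one (by positivity), mul_one,
      ENNReal.ofReal_inv_of_pos (by positivity), ENNReal.ofReal_add one_pos.le c.coe_nonneg]
    simp

/-- The law of the power fading of all the links to a receiver in one time slot. -/
noncomputable def fadingLaw : Measure (ℕ → ℝ) := Measure.infinitePi fun _ => expMeasure 1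

instance : IsProbabilityMeasure fadingLaw := by unfold fadingLaw; infer_instance

lemma iIndepFun_fadingLaw : iIndepFun (fun j (f : ℕ → ℝ) => f j) fadingLaw :=
  iIndepFun_infinitePi (X := fun _ x => x) fun _ => measurable_id

lemma fadingLaw_map_eval (j : ℕ) : fadingLaw.map (fun f => f j) = expMeasure 1 :=
  Measure.infinitePi_map_eval _ j

/-- Independence handles finite products, and the bound 1 allows the passage to the limit. The
interference may be infinite. -/
lemma lintegral_fadingLaw_expNeg_tsum (c : ℕ → ℝ≥0∞) :
    ∫⁻ f, expNeg (∑' j, c j * ENNReal.ofReal (f j)) ∂fadingLaw =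
      expNeg (∑' j, logOneAdd (c j)) := by
  have hg : ∀ j, Measurable fun x : ℝ => expNeg (c j * ENNReal.ofReal x) := fun j => by fun_prop
  have hfin : ∀ n, ∫⁻ f, ∏ j ∈ Finset.range n, expNeg (c j * ENNReal.ofReal (f j)) ∂fadingLaw =
      ∏ j ∈ Finset.range n, expNeg (logOneAdd (c j)) := by
    intro n
    have h := lintegral_prod_eq_prod_lintegral_of_indepFun (Finset.range n) _
      (iIndepFun_fadingLaw.comp _ hg) fun j => (hg j).comp (measurable_pi_apply j)
    simp only [Function.comp_apply] at h
    rw [h]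
    refine Finset.prod_congr rfl fun j _ => ?_
    rw [expNeg_logOneAdd, ← lintegral_expMeasure_expNeg_mul, ← fadingLaw_map_eval j,
      lintegral_map (hg j) (measurable_pi_apply j)]
  refine tendsto_nhds_unique ?_ (tendsto_prod_expNeg fun j => logOneAdd (c j))
  simp_rw [← hfin]
  refine tendsto_lintegral_of_dominated_convergence (fun _ => 1)
    (fun n => Finset.measurable_prod _ fun j _ => (hg j).comp (measurable_pi_apply j))
    (fun n => .of_forall fun f => Finset.prod_le_one' fun j _ => expNeg_le_one _) (by simp)
    (.of_forall fun f => tendsto_prod_expNeg _)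

/-- Since `c i = 0`, the sum is measurable with respect to the coordinates other than `i`. -/
lemma indepFun_fadingLaw_eval_tsum (i : ℕ) (c : ℕ → ℝ≥0∞) (hc : c i = 0) :
    IndepFun (fun f : ℕ → ℝ => f i) (fun f => ∑' j, c j * ENNReal.ofReal (f j)) fadingLaw := by
  have hind : iIndep (fun j => MeasurableSpace.comap (fun f : ℕ → ℝ => f j) inferInstance)
      fadingLaw := iIndepFun_fadingLaw.iIndep
  have h := indep_iSup_of_disjoint (fun j => (measurable_pi_apply j).comap_le) hind
    (S := {i}) (T := {i}ᶜ) (Set.disjoint_compl_right_iff_subset.2 subset_rfl)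
  rw [IndepFun_iff_Indep]
  refine indep_of_indep_of_le h (by simp) ?_
  rw [← measurable_iff_comap_le]
  simp_rw [ENNReal.tsum_eq_iSup_nat]
  refine Measurable.iSup fun n => Finset.measurable_sum _ fun j _ => ?_
  rcases eq_or_ne j i with rfl | hj
  · simp only [hc, zero_mul]
    exact measurable_const
  · refine Measurable.const_mul (ENNReal.measurable_ofReal.comp ?_) _
    rw [measurable_iff_comap_le]
    exact le_iSup₂_of_le j hj le_rfl

/-- Conditioning on the interference gives the exponential tail at `q₀` plus interference; averaging
then gives its Laplace transform. -/
lemma fadingLaw_tsum_le (i : ℕ) (q₀ : ℝ≥0∞) (c : ℕ → ℝ≥0∞) (hc : c i = 0) :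
    fadingLaw {f | q₀ + ∑' j, c j * ENNReal.ofReal (f j) ≤ ENNReal.ofReal (f i)} =
      expNeg (q₀ + ∑' j, logOneAdd (c j)) := by
  have hZ : Measurable fun f : ℕ → ℝ => ∑' j, c j * ENNReal.ofReal (f j) :=
    Measurable.tsum fun j => by fun_prop
  have hS : MeasurableSet {p : ℝ × ℝ≥0∞ | q₀ + p.2 ≤ ENNReal.ofReal p.1} :=
    measurableSet_le (by fun_prop) (by fun_prop)
  have hprod := (indepFun_iff_map_prod_eq_prod_map_map (measurable_pi_apply i).aemeasurable
    hZ.aemeasurable).1 (indepFun_fadingLaw_eval_tsum i c hc)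
  have hpair : Measurable fun f : ℕ → ℝ => (f i, ∑' j, c j * ENNReal.ofReal (f j)) :=
    (measurable_pi_apply i).prodMk hZ
  have h1 : fadingLaw {f | q₀ + ∑' j, c j * ENNReal.ofReal (f j) ≤ ENNReal.ofReal (f i)} =
      (fadingLaw.map fun f => (f i, ∑' j, c j * ENNReal.ofReal (f j)))
        {p | q₀ + p.2 ≤ ENNReal.ofReal p.1} := by
    rw [Measure.map_apply hpair hS]
    rfl
  have := Measure.isProbabilityMeasure_map (μ := fadingLaw) hZ.aemeasurable
  rw [h1, hprod, fadingLaw_map_eval, Measure.prod_apply_symm hS]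
  have h2 : ∀ z, expMeasure 1 ((fun x => (x, z)) ⁻¹' {p : ℝ × ℝ≥0∞ | q₀ + p.2 ≤ ENNReal.ofReal p.1})
      = expNeg q₀ * expNeg z := fun z => by
    rw [← expNeg_add]
    exact expMeasure_le_ofReal (q₀ + z)
  simp_rw [h2]
  rw [lintegral_const_mul _ measurable_expNeg, lintegral_map measurable_expNeg hZ,
    lintegral_fadingLaw_expNeg_tsum, expNeg_add]

/-- The law of the power fading of all the links to a receiver, in all time slots. -/
noncomputable def slotFadingLaw : Measure (ℕ → ℕ → ℝ) := Measure.infinitePi fun _ => fadingLaw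

instance : IsProbabilityMeasure slotFadingLaw := by unfold slotFadingLaw; infer_instance

lemma slotFadingLaw_exists (τ : ℕ) {G : Set (ℕ → ℝ)} (hG : MeasurableSet G) :
    slotFadingLaw {g | ∃ n ∈ Finset.Icc 1 τ, g n ∈ G} = 1 - (1 - fadingLaw G) ^ τ := by
  have h1 : {g : ℕ → ℕ → ℝ | ∃ n ∈ Finset.Icc 1 τ, g n ∈ G} =
      (Set.pi (Finset.Icc 1 τ) fun _ => Gᶜ)ᶜ := by
    ext g
    simp [Set.mem_pi, and_assoc]
  have hm : MeasurableSet (Set.pi (Finset.Icc 1 τ : Set ℕ) fun _ => Gᶜ) :=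
    MeasurableSet.pi (Finset.countable_toSet _) fun _ _ => hG.compl
  rw [h1, prob_compl_eq_one_sub hm, slotFadingLaw, Measure.infinitePi_pi _ fun _ _ => hG.compl]
  simp [prob_compl_eq_one_sub hG]

/-! ### Conditional coverage probability given the positions -/

section Coverage

variable {ℓ : ℝ → ℝ} {snrInv T : ℝ}

/-- The conditional probability, given the transmitters `x`, that a receiver at `y` reaches the
detection threshold in a fixed time slot. -/
noncomputable def slotProb (ℓ : ℝ → ℝ) (snrInv T : ℝ) (x : ℕ → Plane) (i : ℕ) (y : Plane) : ℝ≥0∞ :=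
  expNeg (ENNReal.ofReal (T * ℓ ‖x i - y‖) * ENNReal.ofReal snrInv +
    ∑' j, logOneAdd (if j = i then 0 else
      ENNReal.ofReal (T * ℓ ‖x i - y‖) * (ENNReal.ofReal (ℓ ‖x j - y‖))⁻¹))

/-- The denominator may be 0 or ∞; clearing it is legitimate because the received signal is positive
and finite. -/
lemma le_sinr_iff (hT : 0 ≤ T) {x : ℕ → Plane} {i : ℕ} {y : Plane} (hℓ : 0 < ℓ ‖x i - y‖)
    {f : ℕ → ℝ} (hf : 0 < f i) :
    ENNReal.ofReal T ≤ sinr ℓ snrInv x i y f ↔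
      ENNReal.ofReal (T * ℓ ‖x i - y‖) * ENNReal.ofReal snrInv +
        ∑' j, (if j = i then 0 else
          ENNReal.ofReal (T * ℓ ‖x i - y‖) * (ENNReal.ofReal (ℓ ‖x j - y‖))⁻¹) *
            ENNReal.ofReal (f j) ≤ ENNReal.ofReal (f i) := by
  have hℓ0 : ENNReal.ofReal (ℓ ‖x i - y‖) ≠ 0 := by simpa using hℓ
  have hsum : ∑' j : {j : ℕ // j ≠ i}, ENNReal.ofReal (f j) / ENNReal.ofReal (ℓ ‖x j - y‖) =
      ∑' j, if j = i then 0 else ENNReal.ofReal (f j) / ENNReal.ofReal (ℓ ‖x j - y‖) := by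
    refine (tsum_subtype {j | j ≠ i} fun j =>
      ENNReal.ofReal (f j) / ENNReal.ofReal (ℓ ‖x j - y‖)).trans (tsum_congr fun j => ?_)
    by_cases h : j = i <;> simp [h]
  have hmul : ∑' j, (if j = i then 0 else
          ENNReal.ofReal (T * ℓ ‖x i - y‖) * (ENNReal.ofReal (ℓ ‖x j - y‖))⁻¹) *
            ENNReal.ofReal (f j) = ENNReal.ofReal (T * ℓ ‖x i - y‖) *
      ∑' j, if j = i then 0 else ENNReal.ofReal (f j) / ENNReal.ofReal (ℓ ‖x j - y‖) := by
    rw [← ENNReal.tsum_mul_left]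
    refine tsum_congr fun j => ?_
    by_cases h : j = i
    · simp [h]
    · simp only [h, if_false, div_eq_mul_inv]
      ring
  rw [sinr, hsum, hmul, ← mul_add, ENNReal.le_div_iff_mul_le, ENNReal.le_div_iff_mul_le,
    ENNReal.ofReal_mul hT]
  · rw [mul_right_comm]
  · exact Or.inl hℓ0
  · exact Or.inl ENNReal.ofReal_ne_top
  · refine Or.inr (ENNReal.div_pos ?_ ENNReal.ofReal_ne_top).ne'
    simpa using hf
  · exact Or.inr (ENNReal.div_lt_top ENNReal.ofReal_ne_top hℓ0).ne

lemma fadingLaw_le_sinr (hT : 0 ≤ T) {x : ℕ → Plane} {i : ℕ} {y : Plane}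
    (hℓ : 0 < ℓ ‖x i - y‖) :
    fadingLaw {f | ENNReal.ofReal T ≤ sinr ℓ snrInv x i y f} = slotProb ℓ snrInv T x i y := by
  have hpos : ∀ᵐ f ∂fadingLaw, 0 < f i := by
    have := expMeasure_ae_pos
    rw [← fadingLaw_map_eval i] at this
    exact ae_of_ae_map (measurable_pi_apply i).aemeasurable this
  rw [slotProb, ← fadingLaw_tsum_le i _ _ (if_pos rfl)]
  refine measure_congr ?_
  filter_upwards [hpos] with f hf
  exact propext (le_sinr_iff hT hℓ hf)

lemma measurable_sinr (hℓ : Measurable ℓ) (snrInv : ℝ) (i : ℕ) {α : Type*} [MeasurableSpace α]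
    {x : α → ℕ → Plane} (hx : Measurable x) {y : α → Plane} (hy : Measurable y)
    {f : α → ℕ → ℝ} (hf : Measurable f) :
    Measurable fun a => sinr ℓ snrInv (x a) i (y a) (f a) := by
  unfold sinr
  have hd : ∀ j, Measurable fun a =>
      ENNReal.ofReal (f a j) / ENNReal.ofReal (ℓ ‖x a j - y a‖) := fun j =>
    Measurable.div ((measurable_pi_apply j).comp hf).ennreal_ofReal
      (hℓ.comp (((measurable_pi_apply j).comp hx).sub hy).norm).ennreal_ofReal
  exact (hd i).div (Measurable.const_add (Measurable.tsum fun j : {j // j ≠ i} => hd j) _)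

lemma measurable_slotProb (hℓ : Measurable ℓ) (snrInv T : ℝ) (i : ℕ) {α : Type*}
    [MeasurableSpace α] {x : α → ℕ → Plane} (hx : Measurable x) {y : α → Plane}
    (hy : Measurable y) :
    Measurable fun a => slotProb ℓ snrInv T (x a) i (y a) := by
  unfold slotProb
  have hd : ∀ j, Measurable fun a => ℓ ‖x a j - y a‖ := fun j =>
    hℓ.comp (((measurable_pi_apply j).comp hx).sub hy).norm
  have hq : Measurable fun a => ENNReal.ofReal (T * ℓ ‖x a i - y a‖) :=
    ((hd i).const_mul T).ennreal_ofReal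
  refine measurable_expNeg.comp ((hq.mul_const _).add (Measurable.tsum fun j => ?_))
  refine measurable_logOneAdd.comp ?_
  by_cases h : j = i
  · simp only [h, if_true]
    exact measurable_const
  · simp only [h, if_false]
    exact hq.mul (hd j).ennreal_ofReal.inv

/-- The conditional probability, given the transmitters `x`, that a receiver at `y` is covered. -/
noncomputable def coverProb (ℓ : ℝ → ℝ) (snrInv T : ℝ) (τ : ℕ) (x : ℕ → Plane) (i : ℕ)
    (y : Plane) : ℝ≥0∞ :=
  slotFadingLaw {g | ∃ n ∈ Finset.Icc 1 τ, ENNReal.ofReal T ≤ sinr ℓ snrInv x i y (g n)}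

lemma coverProb_eq (hℓm : Measurable ℓ) (hT : 0 ≤ T) (τ : ℕ) {x : ℕ → Plane} {i : ℕ} {y : Plane}
    (hℓ : 0 < ℓ ‖x i - y‖) :
    coverProb ℓ snrInv T τ x i y = 1 - (1 - slotProb ℓ snrInv T x i y) ^ τ := by
  rw [← fadingLaw_le_sinr hT hℓ]
  exact slotFadingLaw_exists τ (G := {f | ENNReal.ofReal T ≤ sinr ℓ snrInv x i y f})
    (measurableSet_le measurable_const
      (measurable_sinr hℓm snrInv i measurable_const measurable_const measurable_id))

lemma measurableSet_exists_le_sinr (hℓ : Measurable ℓ) (snrInv T : ℝ) (τ i : ℕ) {α : Type*}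
    [MeasurableSpace α] {x : α → ℕ → Plane} (hx : Measurable x) {y : α → Plane} (hy : Measurable y)
    {g : α → ℕ → ℕ → ℝ} (hg : Measurable g) :
    MeasurableSet {a | ∃ n ∈ Finset.Icc 1 τ,
      ENNReal.ofReal T ≤ sinr ℓ snrInv (x a) i (y a) (g a n)} := by
  have : {a | ∃ n ∈ Finset.Icc 1 τ, ENNReal.ofReal T ≤ sinr ℓ snrInv (x a) i (y a) (g a n)} =
      ⋃ n ∈ Finset.Icc 1 τ, {a | ENNReal.ofReal T ≤ sinr ℓ snrInv (x a) i (y a) (g a n)} := by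
    ext a
    simp
  rw [this]
  exact Finset.measurableSet_biUnion _ fun n _ => measurableSet_le measurable_const
    (measurable_sinr hℓ snrInv i hx hy ((measurable_pi_apply n).comp hg))

lemma measurable_coverProb (hℓ : Measurable ℓ) (snrInv T : ℝ) (τ i : ℕ) :
    Measurable fun p : (ℕ → Plane) × Plane => coverProb ℓ snrInv T τ p.1 i p.2 :=
  measurable_measure_prodMk_left (ν := slotFadingLaw)
    (measurableSet_exists_le_sinr hℓ snrInv T τ i (α := ((ℕ → Plane) × Plane) × (ℕ → ℕ → ℝ))
      (x := fun a => a.1.1) (y := fun a => a.1.2) (g := fun a => a.2)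
      (by fun_prop) (by fun_prop) (by fun_prop))

end Coverage

/-! ### Averaging over the receiver clusters -/

section Marking

variable {Ω : Type*} [MeasurableSpace Ω] {P : Measure Ω} [IsProbabilityMeasure P]
  {X : ℕ → Ω → Plane} {C : ℕ → Ω → Cluster} {κ : Kernel Plane Cluster}

lemma lintegral_clusterMeasure {g : Plane → ℝ≥0∞} (hg : Measurable g) (c : Cluster) :
    ∫⁻ y, g y ∂(clusterMeasure c) = ∑ k ∈ Finset.range c.1, g (c.2 k) := by
  rw [clusterMeasure, lintegral_finsetSum_measure]
  simp [lintegral_dirac' _ hg]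

lemma measurable_sum_cluster {α : Type*} [MeasurableSpace α] {g : α → Plane → ℝ≥0∞}
    (hg : Measurable (Function.uncurry g)) :
    Measurable fun p : α × Cluster => ∑ k ∈ Finset.range p.2.1, g p.1 (p.2.2 k) := by
  have : (fun p : α × Cluster => ∑ k ∈ Finset.range p.2.1, g p.1 (p.2.2 k)) =
      fun p => ∑' k, {p : α × Cluster | k < p.2.1}.indicator (fun p => g p.1 (p.2.2 k)) p := by
    ext p
    rw [tsum_eq_sum (s := Finset.range p.2.1)]
    · refine Finset.sum_congr rfl fun k hk => ?_
      rw [Set.indicator_of_mem (by simpa using hk)]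
    · intro k hk
      rw [Set.indicator_of_notMem (by simpa using hk)]
  rw [this]
  refine Measurable.tsum fun k => Measurable.indicator ?_ ?_
  · exact hg.comp (f := fun p : α × Cluster => (p.1, p.2.2 k)) (by fun_prop)
  · exact measurableSet_lt measurable_const (by fun_prop)

lemma measurable_clusterMeasure : Measurable clusterMeasure := by
  refine Measure.measurable_of_measurable_coe _ fun A hA => ?_
  have hone : Measurable (A.indicator (1 : Plane → ℝ≥0∞)) := measurable_one.indicator hA
  have := (measurable_sum_cluster (α := Unit) (g := fun _ => A.indicator 1)
    (hone.comp measurable_snd)).comp (measurable_prodMk_left (x := ()))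
  convert this using 2 with c
  rw [← lintegral_indicator_one hA, lintegral_clusterMeasure hone]
  rfl

/-- Campbell's formula for a cluster: the mean of a sum sees only the mean measure, identified here
as `(κ x).bind clusterMeasure`. -/
lemma lintegral_sum_cluster {lamR R : ℝ}
    (h : ∀ (x : Plane) (A : Set Plane), MeasurableSet A → ∫⁻ c, clusterMeasure c A ∂(κ x) =
      ENNReal.ofReal lamR * volume (A ∩ Metric.closedBall x R))
    (x : Plane) {g : Plane → ℝ≥0∞} (hg : Measurable g) :
    ∫⁻ c, ∑ k ∈ Finset.range c.1, g (c.2 k) ∂(κ x) =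
      ENNReal.ofReal lamR * ∫⁻ y in Metric.closedBall x R, g y := by
  have hbind : (κ x).bind clusterMeasure =
      ENNReal.ofReal lamR • volume.restrict (Metric.closedBall x R) := by
    ext A hA
    rw [Measure.bind_apply hA measurable_clusterMeasure.aemeasurable, h x A hA, Measure.smul_apply,
      Measure.restrict_apply hA, smul_eq_mul]
  simp_rw [← lintegral_clusterMeasure hg]
  rw [← Measure.lintegral_bind measurable_clusterMeasure.aemeasurable hg.aemeasurable, hbind,
    lintegral_smul_measure, smul_eq_mul]

/-- The marking law with `s = {i}` gives the joint law of all points and the `i`-th mark on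
rectangles, which determine it. -/
lemma IsIndependentMarking.lintegral_comp [IsMarkovKernel κ] (h : IsIndependentMarking P X C κ)
    (hX : ∀ i, Measurable (X i)) (i : ℕ) {f : (ℕ → Plane) × Cluster → ℝ≥0∞} (hf : Measurable f) :
    ∫⁻ ω, f (fun j => X j ω, C i ω) ∂P = ∫⁻ ω, ∫⁻ c, f (fun j => X j ω, c) ∂(κ (X i ω)) ∂P := by
  have hX' : Measurable fun ω j => X j ω := measurable_pi_lambda _ hX
  have hXC : Measurable fun ω => ((fun j => X j ω), C i ω) := hX'.prodMk (h.measurable i)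
  let η : Kernel (ℕ → Plane) Cluster := κ.comap (fun x => x i) (measurable_pi_apply i)
  have := Measure.isProbabilityMeasure_map (μ := P) hX'.aemeasurable
  have := Measure.isProbabilityMeasure_map (μ := P) hXC.aemeasurable
  have hmap : P.map (fun ω => ((fun j => X j ω), C i ω)) = (P.map fun ω j => X j ω) ⊗ₘ η := by
    refine Measure.ext_prod fun {D S} hD hS => ?_
    rw [Measure.map_apply hXC (hD.prod hS), Measure.compProd_apply_prod hD hS,
      setLIntegral_map hD (η.measurable_coe hS) hX']
    have hlaw := h.law D {i} (fun _ => S) hD fun _ => hS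
    simp only [Finset.mem_singleton, forall_eq, Finset.prod_singleton] at hlaw
    exact hlaw
  rw [← lintegral_map hf hXC, hmap, Measure.lintegral_compProd hf, lintegral_map _ hX']
  · rfl
  · exact hf.lintegral_kernel_prod_right'

end Marking

/-! ### Averaging the covered count over fading and receivers -/

section Model

variable {Ω : Type*} [MeasurableSpace Ω] {P : Measure Ω}
  {X : ℕ → Ω → Plane} {C : ℕ → Ω → Cluster} {κ : Kernel Plane Cluster}
  {F : ℕ × ℕ × ℕ × ℕ → Ω → ℝ} {lamM lamR R : ℝ}

/-- The links of one receiver form an injectively indexed subfamily of the fading; currying its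
product law separates slots from transmitters. -/
lemma IsMulticastModel.map_fading (h : IsMulticastModel P X C κ F lamM lamR R) (i k : ℕ) :
    P.map (fun ω n j => F (i, k, j, n) ω) = slotFadingLaw := by
  have hinj : Function.Injective fun p : ℕ × ℕ => (i, k, p.2, p.1) := by
    rintro ⟨a, b⟩ ⟨c, d⟩ hab
    simp only [Prod.mk.injEq, true_and] at hab
    exact Prod.ext hab.2 hab.1
  have h1 := (h.fading_indep.precomp hinj).map_fun_eq_infinitePi_map fun p => h.fading_measurable _
  simp_rw [h.fading_law] at h1
  have h2 := Measure.infinitePi_map_curry (ι := ℕ) (κ := ℕ) fun _ _ => expMeasure 1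
  rw [← h1, Measure.map_map (MeasurableEquiv.measurable _)
    (measurable_pi_lambda _ fun p => h.fading_measurable _)] at h2
  exact h2

variable [IsProbabilityMeasure P]

/-- The mean of a functional of a receiver's position and fading is obtained by first averaging
over the fading. -/
lemma IsMulticastModel.lintegral_fading (h : IsMulticastModel P X C κ F lamM lamR R) (i k : ℕ)
    {f : ((ℕ → Plane) × (ℕ → Cluster)) × (ℕ → ℕ → ℝ) → ℝ≥0∞} (hf : Measurable f) :
    ∫⁻ ω, f (((fun j => X j ω), fun j => C j ω), fun n j => F (i, k, j, n) ω) ∂P =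
      ∫⁻ ω, ∫⁻ g, f (((fun j => X j ω), fun j => C j ω), g) ∂slotFadingLaw ∂P := by
  have hXC : Measurable fun ω => ((fun j => X j ω), fun j => C j ω) :=
    (measurable_pi_lambda _ h.transmitters.measurable).prodMk
      (measurable_pi_lambda _ h.clusters.measurable)
  have hG : Measurable fun ω n j => F (i, k, j, n) ω :=
    measurable_pi_lambda _ fun n => measurable_pi_lambda _ fun j => h.fading_measurable _
  have hind : IndepFun (fun ω => ((fun j => X j ω), fun j => C j ω))
      (fun ω n j => F (i, k, j, n) ω) P :=
    h.fading_indep_positions.comp (φ := id)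
      (ψ := fun (q : ℕ × ℕ × ℕ × ℕ → ℝ) (n j : ℕ) => q (i, k, j, n)) measurable_id (by fun_prop)
  have hmap := (indepFun_iff_map_prod_eq_prod_map_map hXC.aemeasurable hG.aemeasurable).1 hind
  rw [h.map_fading] at hmap
  rw [← lintegral_map hf (hXC.prodMk hG), hmap, lintegral_prod _ hf.aemeasurable,
    lintegral_map hf.lintegral_prod_right' hXC]

lemma IsMulticastModel.lintegral_coveredCount [IsMarkovKernel κ]
    (h : IsMulticastModel P X C κ F lamM lamR R)
    {ℓ : ℝ → ℝ} (hℓ : Measurable ℓ) (snrInv T : ℝ) (τ i : ℕ) {B : Set Plane}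
    (hB : MeasurableSet B) :
    ∫⁻ ω, ({ω | X i ω ∈ B} : Set Ω).indicator
        (fun ω => (coveredCount ℓ snrInv T τ X C F i ω : ℝ≥0∞)) ω ∂P =
      ENNReal.ofReal lamR * ∫⁻ ω, B.indicator 1 (X i ω) *
        (∫⁻ y in Metric.closedBall (X i ω) R, coverProb ℓ snrInv T τ (fun j => X j ω) i y) ∂P := by
  classical
  let S : ℕ → Set ((ℕ → Plane) × (ℕ → Cluster)) := fun k => {a | a.1 i ∈ B ∧ k < (a.2 i).1}
  let W : ℕ → Set (((ℕ → Plane) × (ℕ → Cluster)) × (ℕ → ℕ → ℝ)) := fun k =>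
    {a | ∃ n ∈ Finset.Icc 1 τ, ENNReal.ofReal T ≤ sinr ℓ snrInv a.1.1 i ((a.1.2 i).2 k) (a.2 n)}
  have hS : ∀ k, MeasurableSet (S k) := fun k =>
    MeasurableSet.inter (((measurable_pi_apply i).comp measurable_fst) hB)
      (measurableSet_lt measurable_const
        (g := fun a : (ℕ → Plane) × (ℕ → Cluster) => (a.2 i).1) (by fun_prop))
  have hW : ∀ k, MeasurableSet (W k) := fun k =>
    measurableSet_exists_le_sinr hℓ snrInv T τ i
      (α := ((ℕ → Plane) × (ℕ → Cluster)) × (ℕ → ℕ → ℝ)) (x := fun a => a.1.1)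
      (y := fun a => (a.1.2 i).2 k) (g := fun a => a.2) (by fun_prop) (by fun_prop) (by fun_prop)
  let f : ℕ → ((ℕ → Plane) × (ℕ → Cluster)) × (ℕ → ℕ → ℝ) → ℝ≥0∞ := fun k a =>
    (S k).indicator 1 a.1 * (W k).indicator 1 a
  have hf : ∀ k, Measurable (f k) := fun k =>
    ((measurable_one.indicator (hS k)).comp measurable_fst).mul (measurable_one.indicator (hW k))
  have hX' : Measurable fun ω j => X j ω := measurable_pi_lambda _ h.transmitters.measurable
  have hXC : Measurable fun ω => ((fun j => X j ω), fun j => C j ω) :=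
    hX'.prodMk (measurable_pi_lambda _ h.clusters.measurable)
  -- The random number of receivers is absorbed into an indicator, so that for each fixed `k` the
  -- fading can be averaged out; the sum over `k` is reassembled before averaging over the cluster.
  have h1 : ∀ ω, ({ω | X i ω ∈ B} : Set Ω).indicator
      (fun ω => (coveredCount ℓ snrInv T τ X C F i ω : ℝ≥0∞)) ω =
      ∑' k, f k (((fun j => X j ω), fun j => C j ω), fun n j => F (i, k, j, n) ω) := by
    intro ω
    by_cases hω : X i ω ∈ B
    · rw [Set.indicator_of_mem (show ω ∈ {ω | X i ω ∈ B} from hω), coveredCount,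
        Finset.card_filter, tsum_eq_sum (s := Finset.range (C i ω).1)]
      · push_cast
        refine Finset.sum_congr rfl fun k hk => ?_
        simp only [f, S, W, IsCovered, Set.indicator, Set.mem_ofPred_eq, hω, Finset.mem_range.1 hk,
          and_self, if_true, Pi.one_apply, one_mul]
        congr
      · intro k hk
        simp only [f, S, Set.indicator, Set.mem_ofPred_eq, hω, true_and,
          if_neg (Finset.mem_range.not.1 hk), zero_mul]
    · rw [Set.indicator_of_notMem (show ω ∉ {ω | X i ω ∈ B} from hω)]
      simp [f, S, hω]
  have h2 : ∀ k a, ∫⁻ g, f k (a, g) ∂slotFadingLaw =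
      (S k).indicator 1 a * coverProb ℓ snrInv T τ a.1 i ((a.2 i).2 k) := by
    intro k a
    have hWk : Measurable fun g => (W k).indicator (1 : ((ℕ → Plane) × (ℕ → Cluster)) × (ℕ → ℕ → ℝ) → ℝ≥0∞) (a, g) :=
      (measurable_one.indicator (hW k)).comp measurable_prodMk_left
    simp only [f]
    rw [lintegral_const_mul _ hWk, coverProb, ← lintegral_indicator_one]
    · rfl
    · exact measurable_prodMk_left (x := a) (hW k)
  have h3 : ∀ ω, ∑' k, (S k).indicator 1 ((fun j => X j ω), fun j => C j ω) *
      coverProb ℓ snrInv T τ (fun j => X j ω) i ((C i ω).2 k) =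
      B.indicator 1 (X i ω) * ∑ k ∈ Finset.range (C i ω).1,
        coverProb ℓ snrInv T τ (fun j => X j ω) i ((C i ω).2 k) := by
    intro ω
    by_cases hω : X i ω ∈ B
    · rw [tsum_eq_sum (s := Finset.range (C i ω).1), Set.indicator_of_mem hω, Pi.one_apply, one_mul]
      · refine Finset.sum_congr rfl fun k hk => ?_
        simp only [S, Set.indicator, Set.mem_ofPred_eq, hω, Finset.mem_range.1 hk, and_self,
          if_true, Pi.one_apply, one_mul]
      · intro k hk
        simp only [S, Set.indicator, Set.mem_ofPred_eq, hω, true_and,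
          if_neg (Finset.mem_range.not.1 hk), zero_mul]
    · simp [S, hω]
  have hcov := measurable_coverProb hℓ snrInv T τ i
  have h4 : Measurable fun p : (ℕ → Plane) × Cluster =>
      B.indicator (1 : Plane → ℝ≥0∞) (p.1 i) * ∑ k ∈ Finset.range p.2.1,
        coverProb ℓ snrInv T τ p.1 i (p.2.2 k) :=
    ((measurable_one.indicator hB).comp ((measurable_pi_apply i).comp measurable_fst)).mul
      (measurable_sum_cluster (g := fun x y => coverProb ℓ snrInv T τ x i y) hcov)
  have hfm : ∀ k, Measurable fun ω =>
      f k (((fun j => X j ω), fun j => C j ω), fun n j => F (i, k, j, n) ω) := fun k =>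
    (hf k).comp (hXC.prodMk (measurable_pi_lambda _ fun n =>
      measurable_pi_lambda _ fun j => h.fading_measurable _))
  have hCk : ∀ k, Measurable fun ω => (C i ω).2 k := fun k =>
    (measurable_pi_apply k).comp (measurable_snd.comp (h.clusters.measurable i))
  have hSk : ∀ k, Measurable fun ω => (S k).indicator (1 : (ℕ → Plane) × (ℕ → Cluster) → ℝ≥0∞)
      ((fun j => X j ω), fun j => C j ω) := fun k => (measurable_one.indicator (hS k)).comp hXC
  have hck : ∀ k, Measurable fun ω =>
      coverProb ℓ snrInv T τ (fun j => X j ω) i ((C i ω).2 k) := by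
    intro k
    have := hcov.comp (hX'.prodMk (hCk k))
    exact this
  have hcm : ∀ k, Measurable fun ω => (S k).indicator 1 ((fun j => X j ω), fun j => C j ω) *
      coverProb ℓ snrInv T τ (fun j => X j ω) i ((C i ω).2 k) := fun k => (hSk k).mul (hck k)
  simp_rw [h1]
  rw [lintegral_tsum fun k => (hfm k).aemeasurable]
  simp_rw [fun k => h.lintegral_fading i k (hf k), h2]
  rw [← lintegral_tsum fun k => (hcm k).aemeasurable]
  simp_rw [h3]
  rw [h.clusters.lintegral_comp h.transmitters.measurable i h4]
  have h5 : ∀ ω, ∫⁻ c, B.indicator 1 (X i ω) * ∑ k ∈ Finset.range c.1,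
      coverProb ℓ snrInv T τ (fun j => X j ω) i (c.2 k) ∂(κ (X i ω)) =
      ENNReal.ofReal lamR * (B.indicator 1 (X i ω) * ∫⁻ y in Metric.closedBall (X i ω) R,
        coverProb ℓ snrInv T τ (fun j => X j ω) i y) := by
    intro ω
    have hc : Measurable fun y => coverProb ℓ snrInv T τ (fun j => X j ω) i y := by
      have := hcov.comp (measurable_prodMk_left (x := fun j => X j ω))
      exact this
    rw [lintegral_const_mul' (B.indicator 1 (X i ω)), lintegral_sum_cluster h.receiver_intensity _ hc]
    · ring
    · by_cases hω : X i ω ∈ B <;> simp [hω]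
  simp_rw [h5]
  rw [lintegral_const_mul' _ _ ENNReal.ofReal_ne_top]

end Model

/-! ### Polar coordinates in the plane -/

section Radial

lemma integrable_radial {f : ℝ → ℝ} (hf : IntegrableOn (fun s => s * f s) (Set.Ioi 0)) :
    Integrable fun z : Plane => f ‖z‖ := by
  rw [integrable_fun_norm_addHaar]
  simpa using hf

/-- The constant 2π is the dimension times the area π of the unit disc. -/
lemma integral_radial (f : ℝ → ℝ) :
    ∫ z : Plane, f ‖z‖ = 2 * Real.pi * ∫ s in Set.Ioi (0 : ℝ), s * f s := by
  rw [integral_fun_norm_addHaar]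
  simp only [finrank_euclideanSpace, Fintype.card_fin, Measure.real,
    EuclideanSpace.volume_ball_fin_two, nsmul_eq_mul, smul_eq_mul, Nat.add_one_sub_one, pow_one]
  simp [Real.pi_pos.le, mul_assoc]

lemma lintegral_radial {f : ℝ → ℝ} (hf : IntegrableOn (fun s => s * f s) (Set.Ioi 0))
    (hf0 : ∀ s, 0 ≤ s → 0 ≤ f s) (y : Plane) :
    ∫⁻ z, ENNReal.ofReal (f ‖z - y‖) =
      ENNReal.ofReal (2 * Real.pi * ∫ s in Set.Ioi (0 : ℝ), s * f s) := by
  rw [lintegral_sub_right_eq_self (fun z => ENNReal.ofReal (f ‖z‖)), ← integral_radial,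
    ofReal_integral_eq_lintegral_ofReal (integrable_radial hf) (.of_forall fun z => hf0 _ (norm_nonneg z))]

end Radial

/-! ### The interference integral and the constant K -/

section PathLoss

variable {α : ℝ}

lemma one_sub_one_div_pow_nonneg {t : ℝ} (ht : 0 ≤ t) (n : ℕ) : 0 ≤ 1 - 1 / (1 + t) ^ n := by
  have h : (1 : ℝ) ≤ (1 + t) ^ n := one_le_pow₀ (by linarith)
  rw [sub_nonneg, div_le_one (by positivity)]
  exact h

/-- Bernoulli's inequality for (1 - t/(1 + t))ⁿ. -/
lemma one_sub_one_div_pow_le {t : ℝ} (ht : 0 ≤ t) (n : ℕ) : 1 - 1 / (1 + t) ^ n ≤ n * t := by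
  have h0 : (0 : ℝ) < 1 + t := by linarith
  have h1 : 1 / (1 + t) - 1 = -(t / (1 + t)) := by field_simp; ring
  have h2 : t / (1 + t) ≤ t := div_le_self ht (by linarith)
  have h3 : t / (1 + t) ≤ 1 := by rw [div_le_one h0]; linarith
  have h4 := one_add_mul_le_pow (a := 1 / (1 + t) - 1) (by rw [h1]; linarith) n
  rw [add_sub_cancel, one_div_pow, h1] at h4
  have h5 : (n : ℝ) * (t / (1 + t)) ≤ n * t := by gcongr
  linarith

/-- Near 0 the integrand is at most n t^(-2/α), integrable because α > 2; beyond 1 it is at most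
t^(-2/α - 1). -/
lemma integrableOn_rpow_mul_one_sub (hα : 2 < α) (n : ℕ) :
    IntegrableOn (fun t : ℝ => t ^ (-2 / α - 1) * (1 - 1 / (1 + t) ^ n)) (Set.Ioi 0) := by
  have hα0 : 0 < α := by linarith
  have hdiv : 2 / α < 1 := by rw [div_lt_one hα0]; exact hα
  have hdiv0 : 0 < 2 / α := by positivity
  have hmeas : Measurable fun t : ℝ => t ^ (-2 / α - 1) * (1 - 1 / (1 + t) ^ n) := by fun_prop
  rw [← Set.Ioc_union_Ioi_eq_Ioi zero_le_one]
  refine IntegrableOn.union ?_ ?_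
  · have h1 : IntegrableOn (fun t : ℝ => n * t ^ (-2 / α)) (Set.Ioc 0 1) := by
      refine Integrable.const_mul ?_ _
      have := intervalIntegral.intervalIntegrable_rpow' (a := 0) (b := 1) (r := -2 / α)
        (by rw [neg_div]; linarith)
      rwa [intervalIntegrable_iff_integrableOn_Ioc_of_le zero_le_one] at this
    refine h1.mono' hmeas.aestronglyMeasurable ?_
    filter_upwards [ae_restrict_mem measurableSet_Ioc] with t ht
    have ht0 : 0 < t := ht.1
    rw [Real.norm_of_nonneg (mul_nonneg (by positivity) (one_sub_one_div_pow_nonneg ht0.le n))]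
    calc t ^ (-2 / α - 1) * (1 - 1 / (1 + t) ^ n) ≤ t ^ (-2 / α - 1) * (n * t) := by
          gcongr
          exact one_sub_one_div_pow_le ht0.le n
      _ = n * t ^ (-2 / α) := by
          rw [Real.rpow_sub_one ht0.ne']
          field_simp
  · have h1 : IntegrableOn (fun t : ℝ => t ^ (-2 / α - 1)) (Set.Ioi 1) :=
      integrableOn_Ioi_rpow_of_lt (by rw [neg_div]; linarith) one_pos
    refine h1.mono' hmeas.aestronglyMeasurable ?_
    filter_upwards [ae_restrict_mem measurableSet_Ioi] with t ht
    have ht0 : (0 : ℝ) < t := one_pos.trans ht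
    rw [Real.norm_of_nonneg (mul_nonneg (by positivity) (one_sub_one_div_pow_nonneg ht0.le n))]
    refine mul_le_of_le_one_right (by positivity) ?_
    have : 0 ≤ 1 / (1 + t) ^ n := by positivity
    linarith

/-- Prepares the substitution t = c s^(-α): the first factor on the right is the Jacobian of u =
s^(-α), and α⁻¹ c^(2/α + 1) balances the remaining powers. The scaling t = c u later removes one
power of c. -/
lemma mul_one_sub_eq_rpow_comp (hα : 2 < α) {c : ℝ} (hc : 0 < c) (n : ℕ) {s : ℝ} (hs : 0 < s) :
    s * (1 - 1 / (1 + c * s ^ (-α)) ^ n) = (|(-α)| * s ^ (-α - 1)) •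
      (α⁻¹ * c ^ (2 / α + 1) * ((c * s ^ (-α)) ^ (-2 / α - 1) *
        (1 - 1 / (1 + c * s ^ (-α)) ^ n))) := by
  have hα0 : 0 < α := by linarith
  have h1 : (c * s ^ (-α)) ^ (-2 / α - 1) = c ^ (-(2 / α + 1)) * s ^ (2 + α) := by
    rw [Real.mul_rpow hc.le (by positivity), ← Real.rpow_mul hs.le]
    congr 2
    · ring
    · field_simp
      ring
  have h2 : c ^ (2 / α + 1) * c ^ (-(2 / α + 1)) = 1 := by
    rw [← Real.rpow_add hc]
    simp
  have h3 : s ^ (-α - 1) * s ^ (2 + α) = s := by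
    rw [← Real.rpow_add hs]
    ring_nf
    exact Real.rpow_one s
  rw [h1, abs_neg, abs_of_pos hα0, smul_eq_mul]
  calc s * (1 - 1 / (1 + c * s ^ (-α)) ^ n)
      = (α * α⁻¹) * (c ^ (2 / α + 1) * c ^ (-(2 / α + 1))) * (s ^ (-α - 1) * s ^ (2 + α)) *
        (1 - 1 / (1 + c * s ^ (-α)) ^ n) := by
        rw [h2, h3, mul_inv_cancel₀ hα0.ne', one_mul, one_mul]
    _ = _ := by ring

lemma integrableOn_mul_one_sub (hα : 2 < α) {c : ℝ} (hc : 0 < c) (n : ℕ) :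
    IntegrableOn (fun s => s * (1 - 1 / (1 + c * s ^ (-α)) ^ n)) (Set.Ioi 0) := by
  have h1 := (integrableOn_Ioi_comp_mul_left_iff
    (fun t : ℝ => t ^ (-2 / α - 1) * (1 - 1 / (1 + t) ^ n)) 0 hc).2
    (by rw [mul_zero]; exact integrableOn_rpow_mul_one_sub hα n)
  have h2 := (integrableOn_Ioi_comp_rpow_iff _ (p := -α) (by linarith)).2
    (h1.const_mul (α⁻¹ * c ^ (2 / α + 1)))
  exact h2.congr_fun (fun s hs => (mul_one_sub_eq_rpow_comp hα hc n hs).symm) measurableSet_Ioi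

lemma integral_mul_one_sub (hα : 2 < α) {c : ℝ} (hc : 0 < c) (n : ℕ) :
    2 * Real.pi * ∫ s in Set.Ioi (0 : ℝ), s * (1 - 1 / (1 + c * s ^ (-α)) ^ n) =
      K α n * c ^ (2 / α) := by
  rw [setIntegral_congr_fun measurableSet_Ioi fun s hs => mul_one_sub_eq_rpow_comp hα hc n hs,
    integral_comp_rpow_Ioi (fun u => α⁻¹ * c ^ (2 / α + 1) * ((c * u) ^ (-2 / α - 1) *
        (1 - 1 / (1 + c * u) ^ n))) (by linarith : -α ≠ 0), integral_const_mul,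
    integral_comp_mul_left_Ioi (fun t : ℝ => t ^ (-2 / α - 1) * (1 - 1 / (1 + t) ^ n)) 0 hc,
    mul_zero, K, Real.rpow_add_one hc.ne', smul_eq_mul]
  field_simp

lemma K_nonneg (hα : 0 < α) (n : ℕ) : 0 ≤ K α n :=
  mul_nonneg (by positivity) (setIntegral_nonneg measurableSet_Ioi fun t ht =>
    mul_nonneg (Real.rpow_nonneg (le_of_lt ht) _) (one_sub_one_div_pow_nonneg (le_of_lt ht) n))

end PathLoss

/-! ### Palm moments of the slot success probability -/

section Moments

variable {A α T : ℝ}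

/-- The exponent of the contribution of an interferer at `z` to the `n`-th moment of the success
probability of a receiver at `y`. -/
noncomputable def interference (ℓ : ℝ → ℝ) (n : ℕ) (y : Plane) (q : ℝ≥0∞) (z : Plane) : ℝ≥0∞ :=
  n * logOneAdd (q * (ENNReal.ofReal (ℓ ‖z - y‖))⁻¹)

lemma measurable_interference {ℓ : ℝ → ℝ} (hℓ : Measurable ℓ) (n : ℕ) (y : Plane) (q : ℝ≥0∞) :
    Measurable (interference ℓ n y q) := by
  have h : Measurable fun z => (ENNReal.ofReal (ℓ ‖z - y‖))⁻¹ :=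
    (hℓ.comp (measurable_id.sub_const y).norm).ennreal_ofReal.inv
  exact (measurable_logOneAdd.comp (h.const_mul q)).const_mul _

lemma interference_mono (ℓ : ℝ → ℝ) (n : ℕ) (y z : Plane) :
    Monotone fun q => interference ℓ n y q z := fun _ _ h =>
  mul_le_mul_right (logOneAdd_monotone (mul_le_mul_left h _)) _

/-- Monotone sequences matter: where the path loss vanishes the exponent involves q · ∞, which jumps
at q = 0 but is continuous from below. -/
lemma tendsto_interference (ℓ : ℝ → ℝ) (n : ℕ) (y z : Plane) (q : ℕ → ℝ≥0∞) (q' : ℝ≥0∞)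
    (hq : Monotone q) (hlim : Tendsto q atTop (𝓝 q')) :
    Tendsto (fun m => interference ℓ n y (q m) z) atTop (𝓝 (interference ℓ n y q' z)) := by
  obtain rfl := tendsto_nhds_unique hlim (tendsto_atTop_iSup hq)
  refine ENNReal.Tendsto.const_mul ((continuous_logOneAdd.tendsto _).comp ?_)
    (Or.inr (ENNReal.natCast_ne_top n))
  rw [ENNReal.iSup_mul]
  exact tendsto_atTop_iSup fun i j hij => mul_le_mul_left (hq hij) _

lemma expNeg_interference (ℓ : ℝ → ℝ) (n : ℕ) (y : Plane) (q : ℝ≥0∞) (z : Plane) :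
    expNeg (interference ℓ n y q z) = ((1 + q * (ENNReal.ofReal (ℓ ‖z - y‖))⁻¹)⁻¹) ^ n := by
  rw [interference, expNeg_natCast_mul, expNeg_logOneAdd]

/-- The sum is extended to the index `i` itself, whose factor is (1 + T)⁻ⁿ by the choice of q. The
exponent then depends on `i` only through q, as the Mecke formula requires. -/
lemma slotProb_pow (ℓ : ℝ → ℝ) (snrInv : ℝ) (x : ℕ → Plane) (i n : ℕ) {y : Plane}
    (hT : 0 ≤ T) (hℓ : 0 < ℓ ‖x i - y‖) :
    slotProb ℓ snrInv T x i y ^ n =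
      expNeg (n * (ENNReal.ofReal (T * ℓ ‖x i - y‖) * ENNReal.ofReal snrInv)) *
        (1 + ENNReal.ofReal T) ^ n *
        expNeg (∑' j, interference ℓ n y (ENNReal.ofReal (T * ℓ ‖x i - y‖)) (x j)) := by
  set q := ENNReal.ofReal (T * ℓ ‖x i - y‖) with hq
  have hself : q * (ENNReal.ofReal (ℓ ‖x i - y‖))⁻¹ = ENNReal.ofReal T := by
    rw [hq, ENNReal.ofReal_mul hT, mul_assoc, ENNReal.mul_inv_cancel (by simpa using hℓ)
      ENNReal.ofReal_ne_top, mul_one]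
  have hsum : ∑' j, interference ℓ n y q (x j) = interference ℓ n y q (x i) +
      n * ∑' j, logOneAdd (if j = i then 0 else q * (ENNReal.ofReal (ℓ ‖x j - y‖))⁻¹) := by
    rw [ENNReal.tsum_eq_add_tsum_ite i, ← ENNReal.tsum_mul_left]
    congr 1
    refine tsum_congr fun j => ?_
    by_cases h : j = i
    · simp [h, logOneAdd_zero]
    · simp [h, interference]
  have hpow : (1 + ENNReal.ofReal T) ^ n * (1 + ENNReal.ofReal T)⁻¹ ^ n = 1 := by
    rw [← mul_pow, ENNReal.mul_inv_cancel (by simp) (by simp), one_pow]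
  rw [hsum, expNeg_add, expNeg_interference, hself, slotProb, ← hq, ← expNeg_natCast_mul, mul_add,
    expNeg_add]
  calc _ = expNeg (n * (q * ENNReal.ofReal snrInv)) *
        ((1 + ENNReal.ofReal T) ^ n * (1 + ENNReal.ofReal T)⁻¹ ^ n) * expNeg (n * ∑' j, logOneAdd
        (if j = i then 0 else q * (ENNReal.ofReal (ℓ ‖x j - y‖))⁻¹)) := by rw [hpow, mul_one]
    _ = _ := by ring

/-- The constant A cancels, leaving the radial integral with c = T r^α, and c^(2/α) = T^(2/α) r². -/
lemma lintegral_one_sub_expNeg_interference (hA : 0 < A) (hα : 2 < α) (hT : 0 < T) (n : ℕ)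
    {r : ℝ} (hr : 0 < r) (y : Plane) :
    ∫⁻ z, (1 - expNeg (interference (fun s => A * s ^ α) n y (ENNReal.ofReal (T * (A * r ^ α))) z))
      = ENNReal.ofReal (K α n * T ^ (2 / α) * r ^ 2) := by
  have hα0 : 0 < α := by linarith
  have hc : 0 < T * r ^ α := by positivity
  have hcr : (T * r ^ α) ^ (2 / α) = T ^ (2 / α) * r ^ 2 := by
    rw [Real.mul_rpow hT.le (by positivity), ← Real.rpow_mul hr.le,
      mul_div_cancel₀ _ hα0.ne', Real.rpow_two]
  have hae : ∀ᵐ z : Plane, z ≠ y := by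
    rw [ae_iff]
    simp
  rw [mul_assoc, ← hcr, ← integral_mul_one_sub hα hc n,
    ← lintegral_radial (integrableOn_mul_one_sub hα hc n)
      (fun s hs => one_sub_one_div_pow_nonneg (by positivity) n) y]
  refine lintegral_congr_ae ?_
  filter_upwards [hae] with z hz
  have hs : 0 < ‖z - y‖ := norm_pos_iff.2 (sub_ne_zero.2 hz)
  have ht : 0 ≤ T * r ^ α * ‖z - y‖ ^ (-α) := by positivity
  have h1 : ENNReal.ofReal (T * (A * r ^ α)) * (ENNReal.ofReal (A * ‖z - y‖ ^ α))⁻¹ =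
      ENNReal.ofReal (T * r ^ α * ‖z - y‖ ^ (-α)) := by
    rw [← ENNReal.ofReal_inv_of_pos (by positivity), ← ENNReal.ofReal_mul (by positivity)]
    congr 1
    rw [Real.rpow_neg hs.le]
    field_simp
  rw [expNeg_interference, h1, ← ENNReal.ofReal_one, ← ENNReal.ofReal_add zero_le_one ht,
    ← ENNReal.ofReal_inv_of_pos (by positivity), ← ENNReal.ofReal_pow (by positivity),
    ← ENNReal.ofReal_sub _ (by positivity), one_div, inv_pow]

variable {Ω : Type*} [MeasurableSpace Ω] {P : Measure Ω} [IsProbabilityMeasure P]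
  {X : ℕ → Ω → Plane} {lamM snrInv : ℝ}

/-- The Palm moments of the success probability of a receiver at `y`. -/
lemma lintegral_tsum_mul_slotProb_pow (hlamM : 0 ≤ lamM)
    (hX : IsPoissonProcess P X (ENNReal.ofReal lamM • volume)) (hA : 0 < A) (hα : 2 < α)
    (hs : 0 ≤ snrInv) (hT : 0 < T) (n : ℕ) (y : Plane) {w : Plane → ℝ≥0∞} (hw : Measurable w)
    (hwy : w y = 0) (hwfin : ∫⁻ x, w x ≠ ⊤) :
    ∫⁻ ω, ∑' i, w (X i ω) * slotProb (fun s => A * s ^ α) snrInv T (fun j => X j ω) i y ^ n ∂P =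
      ENNReal.ofReal lamM * ∫⁻ x, w x * ENNReal.ofReal
        (Real.exp (-(n * T * snrInv * A * ‖x - y‖ ^ α)) *
          Real.exp (-(lamM * K α n * T ^ (2 / α) * ‖x - y‖ ^ 2))) := by
  set ℓ : ℝ → ℝ := fun s => A * s ^ α with hℓ
  have hℓm : Measurable ℓ := by fun_prop
  have hℓpos : ∀ x, x ≠ y → 0 < ℓ ‖x - y‖ := fun x hx =>
    mul_pos hA (Real.rpow_pos_of_pos (norm_pos_iff.2 (sub_ne_zero.2 hx)) _)
  have hqm : Measurable fun x : Plane => ENNReal.ofReal (T * ℓ ‖x - y‖) :=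
    ((hℓm.comp (measurable_id.sub_const y).norm).const_mul T).ennreal_ofReal
  let φ : Plane → ℝ≥0∞ := fun x =>
    expNeg (n * (ENNReal.ofReal (T * ℓ ‖x - y‖) * ENNReal.ofReal snrInv))
  have hφ : Measurable φ := measurable_expNeg.comp ((hqm.mul_const _).const_mul _)
  have hd : (1 + ENNReal.ofReal T) ^ n ≠ ⊤ := ENNReal.pow_ne_top (by simp)
  let v : Plane → ℝ≥0∞ := fun x => w x * (φ x * (1 + ENNReal.ofReal T) ^ n)
  have hv : Measurable v := hw.mul (hφ.mul_const _)
  have hvfin : ∫⁻ x, v x ∂(ENNReal.ofReal lamM • volume) ≠ ⊤ := by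
    rw [lintegral_smul_measure, smul_eq_mul]
    refine ENNReal.mul_ne_top ENNReal.ofReal_ne_top ?_
    refine ne_top_of_le_ne_top (ENNReal.mul_ne_top hwfin hd) ?_
    rw [← lintegral_mul_const _ hw]
    exact lintegral_mono fun x => mul_le_mul_right (mul_le_of_le_one_left' (expNeg_le_one _)) _
  have hμ : SigmaFinite (ENNReal.ofReal lamM • (volume : Measure Plane)) :=
    inferInstanceAs (SigmaFinite (lamM.toNNReal • (volume : Measure Plane)))
  have key := hX.lintegral_tsum_mul_expNeg hv hvfin hqm (measurable_interference hℓm n y)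
    (interference_mono ℓ n y) (tendsto_interference ℓ n y)
  have hl : ∀ ω i, w (X i ω) * slotProb ℓ snrInv T (fun j => X j ω) i y ^ n = v (X i ω) *
      expNeg (∑' j, interference ℓ n y (ENNReal.ofReal (T * ℓ ‖X i ω - y‖)) (X j ω)) := by
    intro ω i
    -- A transmitter exactly at `y` has zero path loss, outside the scope of `slotProb_pow`; the
    -- weight vanishes there.
    rcases eq_or_ne (X i ω) y with h | h
    · simp [v, h, hwy]
    · rw [slotProb_pow ℓ snrInv _ i n hT.le (hℓpos _ h)]
      simp only [v, φ]
      ring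
  simp_rw [hl]
  rw [key, lintegral_smul_measure, smul_eq_mul]
  congr 1
  refine lintegral_congr fun x => ?_
  rcases eq_or_ne x y with rfl | hx
  · simp [v, hwy]
  have hr : 0 < ‖x - y‖ := norm_pos_iff.2 (sub_ne_zero.2 hx)
  have hself : ENNReal.ofReal (T * ℓ ‖x - y‖) * (ENNReal.ofReal (ℓ ‖x - y‖))⁻¹ =
      ENNReal.ofReal T := by
    rw [ENNReal.ofReal_mul hT.le, mul_assoc, ENNReal.mul_inv_cancel (by simpa using hℓpos x hx)
      ENNReal.ofReal_ne_top, mul_one]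
  have hpow : (1 + ENNReal.ofReal T) ^ n * (1 + ENNReal.ofReal T)⁻¹ ^ n = 1 := by
    rw [← mul_pow, ENNReal.mul_inv_cancel (by simp) (by simp), one_pow]
  have hK := K_nonneg (α := α) (by linarith) n
  rw [lintegral_smul_measure, smul_eq_mul,
    lintegral_one_sub_expNeg_interference hA hα hT n hr y, expNeg_interference, hself,
    ← ENNReal.ofReal_mul hlamM, expNeg_ofReal (by positivity)]
  have hφx : φ x = ENNReal.ofReal (Real.exp (-(n * T * snrInv * A * ‖x - y‖ ^ α))) := by
    simp only [φ, hℓ]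
    rw [← ENNReal.ofReal_mul (by positivity), ← ENNReal.ofReal_natCast,
      ← ENNReal.ofReal_mul (by positivity), expNeg_ofReal (by positivity)]
    congr 3
    ring
  rw [ENNReal.ofReal_mul (by positivity), ← hφx]
  -- The Mecke self term at x is (1 + T)⁻ⁿ, which cancels the compensating factor in `v`.
  calc _ = w x * (φ x * ((1 + ENNReal.ofReal T) ^ n * (1 + ENNReal.ofReal T)⁻¹ ^ n) *
        ENNReal.ofReal (Real.exp (-(lamM * (K α n * T ^ (2 / α) * ‖x - y‖ ^ 2))))) := by
        simp only [v]; ring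
    _ = _ := by
        rw [hpow, mul_one]
        congr 5
        ring

end Moments

/-! ### The measure over transmitters in the window and positions in their discs -/

section Window

variable {Ω : Type*} [MeasurableSpace Ω] {P : Measure Ω} {X : ℕ → Ω → Plane} {B : Set Plane} {R : ℝ}

lemma IsMulticastModel.measurable_coveredCount {C : ℕ → Ω → Cluster} {κ : Kernel Plane Cluster}
    {F : ℕ × ℕ × ℕ × ℕ → Ω → ℝ} {lamM lamR : ℝ} (h : IsMulticastModel P X C κ F lamM lamR R)
    {ℓ : ℝ → ℝ} (hℓ : Measurable ℓ) (snrInv T : ℝ) (τ i : ℕ) :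
    Measurable fun ω => (coveredCount ℓ snrInv T τ X C F i ω : ℝ≥0∞) := by
  classical
  have hCk : ∀ k, Measurable fun ω => (C i ω).2 k := fun k =>
    (measurable_pi_apply k).comp (measurable_snd.comp (h.clusters.measurable i))
  have hcov : ∀ k, MeasurableSet {ω | IsCovered ℓ snrInv T τ X C F i k ω} := fun k =>
    measurableSet_exists_le_sinr hℓ snrInv T τ i
      (measurable_pi_lambda _ h.transmitters.measurable) (hCk k)
      (measurable_pi_lambda _ fun n => measurable_pi_lambda _ fun j =>
        h.fading_measurable (i, k, j, n))
  have hlt : ∀ k, MeasurableSet {ω | k < (C i ω).1} := fun k =>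
    measurableSet_lt measurable_const (measurable_fst.comp (h.clusters.measurable i))
  have heq : (fun ω => (coveredCount ℓ snrInv T τ X C F i ω : ℝ≥0∞)) = fun ω =>
      ∑' k, ({ω | k < (C i ω).1} ∩ {ω | IsCovered ℓ snrInv T τ X C F i k ω}).indicator 1 ω := by
    funext ω
    rw [coveredCount, Finset.card_filter, tsum_eq_sum (s := Finset.range (C i ω).1)]
    · push_cast
      refine Finset.sum_congr rfl fun k hk => ?_
      simp only [Set.indicator, Set.mem_inter_iff, Set.mem_ofPred_eq, Finset.mem_range.1 hk,
        true_and, Pi.one_apply]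
    · intro k hk
      rw [Set.indicator_of_notMem]
      exact fun h' => hk (Finset.mem_range.2 h'.1)
  rw [heq]
  exact Measurable.tsum fun k => measurable_one.indicator ((hlt k).inter (hcov k))

/-- The triples of an index `i`, a scenario `ω` and a position `y` such that `X i ω` lies in the
window `B` and `y` in the punctured disc of radius `R` about `X i ω`. -/
def windowSet (X : ℕ → Ω → Plane) (B : Set Plane) (R : ℝ) : Set (ℕ × Ω × Plane) :=
  {a | X a.1 a.2.1 ∈ B ∧ ‖X a.1 a.2.1 - a.2.2‖ ∈ Set.Ioc 0 R}

/-- The measure that integrates over the points in the window `B` and over the positions in the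
discs of radius `R` about them. -/
noncomputable def windowMeasure (P : Measure Ω) (X : ℕ → Ω → Plane) (B : Set Plane) (R : ℝ) :
    Measure (ℕ × Ω × Plane) :=
  (Measure.count.prod (P.prod volume)).restrict (windowSet X B R)

lemma measurable_uncurry_points (hX : ∀ i, Measurable (X i)) :
    Measurable fun a : ℕ × Ω × Plane => X a.1 a.2.1 :=
  measurable_from_prod_countable_right fun i => (hX i).comp measurable_fst

lemma measurableSet_windowSet (hX : ∀ i, Measurable (X i)) (hB : MeasurableSet B) :
    MeasurableSet (windowSet X B R) :=
  (measurable_uncurry_points hX hB).inter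
    (((measurable_uncurry_points hX).sub (by fun_prop)).norm measurableSet_Ioc)

variable [SFinite P]

lemma lintegral_windowMeasure (hX : ∀ i, Measurable (X i)) (hB : MeasurableSet B)
    {f : ℕ × Ω × Plane → ℝ≥0∞} (hf : Measurable f) :
    ∫⁻ a, f a ∂(windowMeasure P X B R) =
      ∑' i, ∫⁻ ω, (∫⁻ y, (windowSet X B R).indicator f (i, ω, y)) ∂P := by
  have hS := measurableSet_windowSet (R := R) hX hB
  have hm : Measurable ((windowSet X B R).indicator f) := hf.indicator hS
  have hmi : ∀ i, Measurable fun p : Ω × Plane => (windowSet X B R).indicator f (i, p) := fun i =>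
    hm.comp measurable_prodMk_left
  rw [windowMeasure, ← lintegral_indicator hS, lintegral_prod _ hm.aemeasurable,
    MeasureTheory.lintegral_count]
  exact tsum_congr fun i => lintegral_prod _ (hmi i).aemeasurable

/-- With y outermost, the Mecke formula can be applied at a fixed receiver position. -/
lemma lintegral_windowMeasure_symm (hX : ∀ i, Measurable (X i)) (hB : MeasurableSet B)
    {f : ℕ × Ω × Plane → ℝ≥0∞} (hf : Measurable f) :
    ∫⁻ a, f a ∂(windowMeasure P X B R) =
      ∫⁻ y, ∫⁻ ω, ∑' i, (windowSet X B R).indicator f (i, ω, y) ∂P := by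
  have hm : Measurable ((windowSet X B R).indicator f) :=
    hf.indicator (measurableSet_windowSet hX hB)
  have hmi : ∀ i, Measurable fun p : Ω × Plane => (windowSet X B R).indicator f (i, p) := fun i =>
    hm.comp measurable_prodMk_left
  have hmy : ∀ i y, Measurable fun ω => (windowSet X B R).indicator f (i, ω, y) := fun i y =>
    (hmi i).comp measurable_prodMk_right
  rw [lintegral_windowMeasure hX hB hf]
  simp_rw [fun y => lintegral_tsum (μ := P) fun i => (hmy i y).aemeasurable]
  rw [lintegral_tsum fun i => (hmi i).lintegral_prod_left'.aemeasurable]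
  refine tsum_congr fun i => ?_
  rw [lintegral_lintegral_swap (hmi i).aemeasurable]

end Window

/-! ### Moments integrated over the window -/

section WindowMoments

variable {Ω : Type*} [MeasurableSpace Ω] {P : Measure Ω} [IsProbabilityMeasure P]
  {X : ℕ → Ω → Plane} {B : Set Plane} {A α T R lamM snrInv : ℝ}

/-- The `n`-th Palm moment of the success probability, as a function of the distance of a receiver
from its transmitter. -/
noncomputable def momentAt (A α T lamM snrInv : ℝ) (n : ℕ) (r : ℝ) : ℝ :=
  Real.exp (-(n * T * snrInv * A * r ^ α)) * Real.exp (-(lamM * K α n * T ^ (2 / α) * r ^ 2))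

lemma continuous_momentAt (hα : 2 < α) (n : ℕ) : Continuous (momentAt A α T lamM snrInv n) := by
  have : Continuous fun r : ℝ => r ^ α := Real.continuous_rpow_const (by linarith)
  unfold momentAt
  fun_prop

lemma lintegral_indicator_momentAt (hα : 2 < α) (hR : 0 < R) (n : ℕ) (x : Plane) :
    ∫⁻ y, ENNReal.ofReal ((Set.Ioc 0 R).indicator (momentAt A α T lamM snrInv n) ‖x - y‖) =
      ENNReal.ofReal (2 * Real.pi * ∫ r in (0 : ℝ)..R, r * momentAt A α T lamM snrInv n r) := by
  set F := momentAt A α T lamM snrInv n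
  have hmul : (fun s => s * (Set.Ioc 0 R).indicator F s) =
      (Set.Ioc 0 R).indicator fun s => s * F s := by
    funext s
    by_cases h : s ∈ Set.Ioc 0 R <;> simp [h]
  have hint : IntegrableOn (fun s => s * F s) (Set.Ioc 0 R) :=
    ((continuous_id.mul (continuous_momentAt hα n)).integrableOn_Icc (a := 0) (b := R)).mono_set
      Set.Ioc_subset_Icc_self
  have hI : IntegrableOn (fun s => s * (Set.Ioc 0 R).indicator F s) (Set.Ioi 0) := by
    rw [hmul]
    exact ((integrable_indicator_iff measurableSet_Ioc).2 hint).integrableOn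
  simp_rw [norm_sub_rev x]
  rw [lintegral_radial hI fun s _ => Set.indicator_nonneg (fun s _ => by
      simp only [F, momentAt]; positivity) s, hmul, setIntegral_indicator measurableSet_Ioc,
    Set.inter_eq_right.2 fun s hs => hs.1, intervalIntegral.integral_of_le hR.le]

lemma lintegral_windowMeasure_slotProb_pow (hlamM : 0 ≤ lamM)
    (hX : IsPoissonProcess P X (ENNReal.ofReal lamM • volume)) (hA : 0 < A) (hα : 2 < α)
    (hs : 0 ≤ snrInv) (hT : 0 < T) (hR : 0 < R) (n : ℕ) (hB : MeasurableSet B)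
    (hBfin : volume B ≠ ⊤) :
    ∫⁻ a, slotProb (fun s => A * s ^ α) snrInv T (fun j => X j a.2.1) a.1 a.2.2 ^ n
        ∂(windowMeasure P X B R) =
      ENNReal.ofReal lamM * volume B * ENNReal.ofReal
        (2 * Real.pi * ∫ r in (0 : ℝ)..R, r * momentAt A α T lamM snrInv n r) := by
  have hXm := hX.measurable
  have hℓm : Measurable fun s : ℝ => A * s ^ α := by fun_prop
  have hp : Measurable fun a : ℕ × Ω × Plane =>
      slotProb (fun s => A * s ^ α) snrInv T (fun j => X j a.2.1) a.1 a.2.2 := by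
    refine measurable_from_prod_countable_right fun i => ?_
    exact measurable_slotProb hℓm snrInv T i
      (measurable_pi_lambda _ fun j => (hXm j).comp measurable_fst) measurable_snd
  rw [lintegral_windowMeasure_symm hXm hB (hp.pow_const n)]
  let w : Plane → Plane → ℝ≥0∞ := fun y =>
    (B ∩ {x | ‖x - y‖ ∈ Set.Ioc 0 R}).indicator 1
  have hwset : ∀ y, MeasurableSet (B ∩ {x : Plane | ‖x - y‖ ∈ Set.Ioc 0 R}) := fun y =>
    hB.inter ((measurable_id.sub_const y).norm measurableSet_Ioc)
  have h1 : ∀ y, ∫⁻ ω, ∑' i, (windowSet X B R).indicator (fun a => slotProb (fun s => A * s ^ α)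
      snrInv T (fun j => X j a.2.1) a.1 a.2.2 ^ n) (i, ω, y) ∂P =
      ENNReal.ofReal lamM * ∫⁻ x, w y x * ENNReal.ofReal (momentAt A α T lamM snrInv n ‖x - y‖) := by
    intro y
    have := lintegral_tsum_mul_slotProb_pow (A := A) (α := α) (snrInv := snrInv) hlamM hX hA hα hs
      hT n y (w := w y) (measurable_one.indicator (hwset y)) (by simp [w]) (by
        refine ne_top_of_le_ne_top hBfin ?_
        rw [lintegral_indicator_one (hwset y)]
        exact measure_mono Set.inter_subset_left)
    rw [← show _ = ENNReal.ofReal lamM * ∫⁻ x, w y x *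
      ENNReal.ofReal (momentAt A α T lamM snrInv n ‖x - y‖) from this]
    refine lintegral_congr fun ω => tsum_congr fun i => ?_
    by_cases h : (i, ω, y) ∈ windowSet X B R
    · have h' : X i ω ∈ B ∩ {x : Plane | ‖x - y‖ ∈ Set.Ioc 0 R} := h
      rw [Set.indicator_of_mem h]
      simp only [w]
      rw [Set.indicator_of_mem h', Pi.one_apply, one_mul]
    · have h' : X i ω ∉ B ∩ {x : Plane | ‖x - y‖ ∈ Set.Ioc 0 R} := h
      rw [Set.indicator_of_notMem h]
      simp only [w]
      rw [Set.indicator_of_notMem h', zero_mul]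
  simp_rw [h1]
  rw [lintegral_const_mul' _ _ ENNReal.ofReal_ne_top, mul_assoc]
  congr 1
  -- The integrand splits into a function of x and one of ‖x - y‖. After the swap, the y-integral
  -- does not depend on x and the x-integral is |B|.
  have h2 : ∀ y x, w y x * ENNReal.ofReal (momentAt A α T lamM snrInv n ‖x - y‖) =
      B.indicator 1 x *
        ENNReal.ofReal ((Set.Ioc 0 R).indicator (momentAt A α T lamM snrInv n) ‖x - y‖) := by
    intro y x
    by_cases hx : x ∈ B <;> by_cases hr : ‖x - y‖ ∈ Set.Ioc 0 R <;>
      simp only [w, Set.indicator, Set.mem_inter_iff, Set.mem_ofPred_eq, hx, hr, and_self,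
        and_true, and_false, if_true, if_false, Pi.one_apply, one_mul, zero_mul,
        ENNReal.ofReal_zero, mul_zero]
  simp_rw [h2]
  have hone : Measurable (B.indicator (1 : Plane → ℝ≥0∞)) := measurable_one.indicator hB
  have hF : Measurable ((Set.Ioc 0 R).indicator (momentAt A α T lamM snrInv n)) :=
    (continuous_momentAt hα n).measurable.indicator measurableSet_Ioc
  rw [lintegral_lintegral_swap]
  · have h3 : ∀ x, ∫⁻ y, B.indicator 1 x * ENNReal.ofReal
        ((Set.Ioc 0 R).indicator (momentAt A α T lamM snrInv n) ‖x - y‖) =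
        B.indicator 1 x * ENNReal.ofReal
          (2 * Real.pi * ∫ r in (0 : ℝ)..R, r * momentAt A α T lamM snrInv n r) := by
      intro x
      rw [lintegral_const_mul' (B.indicator 1 x) _ (by by_cases hx : x ∈ B <;> simp [hx]),
        lintegral_indicator_momentAt hα hR]
    simp_rw [h3]
    rw [lintegral_mul_const _ hone, lintegral_indicator_one hB]
  · exact ((hone.comp measurable_snd).mul
      (hF.comp (measurable_snd.sub measurable_fst).norm).ennreal_ofReal).aemeasurable

end WindowMoments

/-! ### Binomial expansion of the coverage probability -/

lemma one_sub_one_sub_pow (p : ℝ) (τ : ℕ) :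
    1 - (1 - p) ^ τ = ∑ n ∈ Finset.Icc 1 τ, (-1 : ℝ) ^ (n + 1) * (τ.choose n : ℝ) * p ^ n := by
  have h := add_pow (-p) 1 τ
  rw [Finset.range_eq_Ico, Finset.sum_eq_sum_Ico_succ_bot (Nat.succ_pos τ)] at h
  have h1 : Finset.Ico (0 + 1) τ.succ = Finset.Icc 1 τ := by
    ext n
    simp
  simp only [h1, pow_zero, one_pow, mul_one, Nat.choose_zero_right, Nat.cast_one] at h
  rw [show 1 - p = -p + 1 by ring, h, sub_add_cancel_left, ← Finset.sum_neg_distrib]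
  refine Finset.sum_congr rfl fun n _ => ?_
  rw [neg_pow]
  ring

lemma toReal_one_sub_one_sub_pow {p : ℝ≥0∞} (hp : p ≤ 1) (τ : ℕ) :
    (1 - (1 - p) ^ τ).toReal =
      ∑ n ∈ Finset.Icc 1 τ, (-1 : ℝ) ^ (n + 1) * (τ.choose n : ℝ) * (p ^ n).toReal := by
  simp_rw [ENNReal.toReal_pow]
  rw [← one_sub_one_sub_pow, ENNReal.toReal_sub_of_le (pow_le_one' tsub_le_self τ) ENNReal.one_ne_top,
    ENNReal.toReal_pow, ENNReal.toReal_sub_of_le hp ENNReal.one_ne_top, ENNReal.toReal_one]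

section Binomial

variable {β : Type*} [MeasurableSpace β] {Q : Measure β} [IsFiniteMeasure Q] {p : β → ℝ≥0∞}

/-- The alternating signs force a passage to ℝ; finiteness of `Q` makes every moment integrable. -/
lemma toReal_lintegral_one_sub_one_sub_pow (hp : Measurable p) (hp1 : ∀ a, p a ≤ 1) (τ : ℕ) :
    (∫⁻ a, (1 - (1 - p a) ^ τ) ∂Q).toReal = ∑ n ∈ Finset.Icc 1 τ,
      (-1 : ℝ) ^ (n + 1) * (τ.choose n : ℝ) * (∫⁻ a, p a ^ n ∂Q).toReal := by
  have hpn : ∀ n a, p a ^ n ≤ 1 := fun n a => pow_le_one' (hp1 a) n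
  have hlt : ∀ n, ∀ᵐ a ∂Q, p a ^ n < ⊤ := fun n =>
    .of_forall fun a => (hpn n a).trans_lt ENNReal.one_lt_top
  have hm : Measurable fun a => 1 - (1 - p a) ^ τ := (((hp.const_sub 1).pow_const τ).const_sub 1)
  rw [← integral_toReal hm.aemeasurable
    (.of_forall fun a => (tsub_le_self (a := 1)).trans_lt ENNReal.one_lt_top)]
  simp_rw [fun a => toReal_one_sub_one_sub_pow (hp1 a) τ]
  rw [integral_finsetSum]
  · refine Finset.sum_congr rfl fun n _ => ?_
    rw [integral_const_mul, integral_toReal (hp.pow_const n).aemeasurable (hlt n)]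
  · intro n _
    refine Integrable.const_mul (integrable_toReal_of_lintegral_ne_top
      (hp.pow_const n).aemeasurable ?_) _
    refine ne_top_of_le_ne_top (measure_ne_top Q Set.univ) ?_
    exact (lintegral_mono (hpn n)).trans (by simp)

end Binomial

/-! ### Covered receivers in the window and the final formula -/

section Palm

variable {Ω : Type*} [MeasurableSpace Ω] {P : Measure Ω} [IsProbabilityMeasure P]
  {X : ℕ → Ω → Plane} {C : ℕ → Ω → Cluster} {κ : Kernel Plane Cluster} [IsMarkovKernel κ]
  {F : ℕ × ℕ × ℕ × ℕ → Ω → ℝ} {lamM lamR R A α snrInv T : ℝ} {B : Set Plane}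

lemma slotProb_le_one (ℓ : ℝ → ℝ) (snrInv T : ℝ) (x : ℕ → Plane) (i : ℕ) (y : Plane) :
    slotProb ℓ snrInv T x i y ≤ 1 := expNeg_le_one _

lemma measurable_slotProb_window (hX : ∀ i, Measurable (X i)) (A α snrInv T : ℝ) :
    Measurable fun a : ℕ × Ω × Plane =>
      slotProb (fun s => A * s ^ α) snrInv T (fun j => X j a.2.1) a.1 a.2.2 :=
  measurable_from_prod_countable_right fun i => measurable_slotProb (by fun_prop) snrInv T i
    (measurable_pi_lambda _ fun j => (hX j).comp measurable_fst) measurable_snd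

/-- The mean number of covered receivers of the transmitters in the window `B`. -/
lemma IsMulticastModel.lintegral_tsum_coveredCount (h : IsMulticastModel P X C κ F lamM lamR R)
    (hA : 0 < A) (hT : 0 < T) (τ : ℕ) (hB : MeasurableSet B) :
    ∫⁻ ω, ∑' i, ({ω | X i ω ∈ B} : Set Ω).indicator (fun ω =>
        (coveredCount (fun s => A * s ^ α) snrInv T τ X C F i ω : ℝ≥0∞)) ω ∂P =
      ENNReal.ofReal lamR * ∫⁻ a, (1 - (1 - slotProb (fun s => A * s ^ α) snrInv T
        (fun j => X j a.2.1) a.1 a.2.2) ^ τ) ∂(windowMeasure P X B R) := by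
  have hXm := h.transmitters.measurable
  have hℓm : Measurable fun s : ℝ => A * s ^ α := by fun_prop
  have hf : Measurable fun a : ℕ × Ω × Plane => 1 - (1 - slotProb (fun s => A * s ^ α) snrInv T
      (fun j => X j a.2.1) a.1 a.2.2) ^ τ :=
    (((measurable_slotProb_window hXm A α snrInv T).const_sub 1).pow_const τ).const_sub 1
  have hcount : ∀ i, Measurable (({ω | X i ω ∈ B} : Set Ω).indicator fun ω =>
      (coveredCount (fun s => A * s ^ α) snrInv T τ X C F i ω : ℝ≥0∞)) := fun i =>
    (h.measurable_coveredCount hℓm snrInv T τ i).indicator (hXm i hB)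
  rw [lintegral_tsum fun i => (hcount i).aemeasurable]
  simp_rw [fun i => h.lintegral_coveredCount hℓm snrInv T τ i hB]
  rw [ENNReal.tsum_mul_left, lintegral_windowMeasure hXm hB hf]
  congr 1
  refine tsum_congr fun i => lintegral_congr fun ω => ?_
  by_cases hω : X i ω ∈ B
  · rw [Set.indicator_of_mem hω, Pi.one_apply, one_mul,
      ← lintegral_indicator Metric.isClosed_closedBall.measurableSet]
    -- The centre of the disc has zero path loss, where `coverProb_eq` does not apply; it is a null
    -- set and is absent from `windowSet`.
    have hae : ∀ᵐ y : Plane, y ≠ X i ω := by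
      rw [ae_iff]
      simp
    refine lintegral_congr_ae ?_
    filter_upwards [hae] with y hy
    have hpos : 0 < ‖X i ω - y‖ := norm_pos_iff.2 (sub_ne_zero.2 hy.symm)
    by_cases hr : ‖X i ω - y‖ ≤ R
    · rw [Set.indicator_of_mem (show (i, ω, y) ∈ windowSet X B R from ⟨hω, hpos, hr⟩),
        Set.indicator_of_mem (by rwa [Metric.mem_closedBall, dist_eq_norm, norm_sub_rev]),
        coverProb_eq hℓm hT.le τ (by positivity)]
    · rw [Set.indicator_of_notMem (show (i, ω, y) ∉ windowSet X B R from fun h' => hr h'.2.2),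
        Set.indicator_of_notMem (by rwa [Metric.mem_closedBall, dist_eq_norm, norm_sub_rev])]
  · rw [Set.indicator_of_notMem hω, zero_mul]
    have : ∀ y, (i, ω, y) ∉ windowSet X B R := fun y h' => hω h'.1
    simp [this]

end Palm

end MulticastD2D

theorem proposition2 {Ω : Type*} [MeasurableSpace Ω] (P : Measure Ω) [IsProbabilityMeasure P]
    (X : ℕ → Ω → MulticastD2D.Plane) (C : ℕ → Ω → MulticastD2D.Cluster)
    (κ : Kernel MulticastD2D.Plane MulticastD2D.Cluster) [IsMarkovKernel κ]
    (F : ℕ × ℕ × ℕ × ℕ → Ω → ℝ) (lamM lamR R : ℝ)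
    (hlamM : 0 < lamM) (hlamR : 0 < lamR) (hR : 0 < R)
    (hmodel : MulticastD2D.IsMulticastModel P X C κ F lamM lamR R)
    (A α : ℝ) (hA : 0 < A) (hα : 2 < α)
    (σ2 Pm : ℝ) (hσ2 : 0 ≤ σ2) (hPm : 0 < Pm)
    (T : ℝ) (hT : 0 < T) (τ : ℕ)
    (B : Set MulticastD2D.Plane) (hB : MeasurableSet B) (hBb : Bornology.IsBounded B)
    (hB0 : volume B ≠ 0) :
    MulticastD2D.palmExpectation P X lamM B (fun i ω =>
        (MulticastD2D.coveredCount (fun r => A * r ^ α) (σ2 / Pm) T τ X C F i ω : ℝ≥0∞)) ≠ ⊤ ∧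
    (MulticastD2D.palmExpectation P X lamM B (fun i ω =>
        (MulticastD2D.coveredCount (fun r => A * r ^ α) (σ2 / Pm) T τ X C F i ω : ℝ≥0∞))).toReal =
      2 * Real.pi * lamR * ∑ n ∈ Finset.Icc 1 τ, (-1 : ℝ) ^ (n + 1) * (τ.choose n : ℝ) *
        ∫ r in (0 : ℝ)..R, r * Real.exp (-(n * T * (σ2 / Pm) * A * r ^ α)) *
          Real.exp (-(lamM * MulticastD2D.K α n * T ^ (2 / α) * r ^ 2)) := by
  have hs : 0 ≤ σ2 / Pm := by positivity
  have hBfin : volume B ≠ ⊤ := hBb.measure_lt_top.ne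
  have hmom := fun n => MulticastD2D.lintegral_windowMeasure_slotProb_pow hlamM.le
    hmodel.transmitters hA hα hs hT hR n hB hBfin
  have hfin : IsFiniteMeasure (MulticastD2D.windowMeasure P X B R) := by
    refine ⟨?_⟩
    -- The zeroth moment is the total mass of the window measure.
    have h0 := hmom 0
    simp only [pow_zero, lintegral_one] at h0
    rw [h0]
    exact (ENNReal.mul_ne_top (ENNReal.mul_ne_top ENNReal.ofReal_ne_top hBfin)
      ENNReal.ofReal_ne_top).lt_top
  have hreal := MulticastD2D.toReal_lintegral_one_sub_one_sub_pow
    (Q := MulticastD2D.windowMeasure P X B R)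
    (MulticastD2D.measurable_slotProb_window hmodel.transmitters.measurable A α (σ2 / Pm) T)
    (fun a => MulticastD2D.slotProb_le_one _ _ _ _ _ _) τ
  have hJ : ∫⁻ a, (1 - (1 - MulticastD2D.slotProb (fun s => A * s ^ α) (σ2 / Pm) T
      (fun j => X j a.2.1) a.1 a.2.2) ^ τ) ∂(MulticastD2D.windowMeasure P X B R) ≠ ⊤ :=
    ne_top_of_le_ne_top (measure_ne_top (MulticastD2D.windowMeasure P X B R) Set.univ)
      ((lintegral_mono fun _ => tsub_le_self).trans lintegral_one.le)
  have hden : ENNReal.ofReal lamM * volume B ≠ 0 := mul_ne_zero (by simpa using hlamM) hB0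
  have hb : 0 < (volume B).toReal := ENNReal.toReal_pos hB0 hBfin
  rw [MulticastD2D.palmExpectation,
    hmodel.lintegral_tsum_coveredCount (snrInv := σ2 / Pm) hA hT τ hB]
  refine ⟨ENNReal.div_ne_top (ENNReal.mul_ne_top ENNReal.ofReal_ne_top hJ) hden, ?_⟩
  rw [ENNReal.toReal_div, ENNReal.toReal_mul, ENNReal.toReal_mul, ENNReal.toReal_ofReal hlamR.le,
    ENNReal.toReal_ofReal hlamM.le, hreal, Finset.mul_sum, Finset.mul_sum, Finset.sum_div]
  refine Finset.sum_congr rfl fun n _ => ?_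
  have hI : 0 ≤ ∫ r in (0 : ℝ)..R, r * MulticastD2D.momentAt A α T lamM (σ2 / Pm) n r :=
    intervalIntegral.integral_nonneg hR.le fun r hr => mul_nonneg hr.1
      (by unfold MulticastD2D.momentAt; positivity)
  rw [hmom n, ENNReal.toReal_mul, ENNReal.toReal_mul, ENNReal.toReal_ofReal hlamM.le,
    ENNReal.toReal_ofReal (by positivity)]
  simp only [MulticastD2D.momentAt, ← mul_assoc]
  -- Both sides contain the same integral; what remains is the cancellation of λ_m |B|.
  generalize (∫ r in (0 : ℝ)..R, r * Real.exp (-(n * T * (σ2 / Pm) * A * r ^ α)) *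
    Real.exp (-(lamM * MulticastD2D.K α n * T ^ (2 / α) * r ^ 2))) = I
  field_simp
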